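/- **Staircase tableaux.** A staircase tableau of size $n\ge 0$ is a filling of the Young diagram of shape $(n,n-1,\dots,2,1)$ in which each box is empty or labeled $\alpha,\beta,\gamma$ or $\delta$, such that no box on the diagonal is empty, all boxes in the same row and to the left of a $\beta$ or $\delta$ are empty, and all boxes in the same column and above an $\alpha$ or $\gamma$ are empty. The weight $\mathrm{wt}(T)$ is the product over all boxes, where a labeled box contributes its label, and an empty box contributes $1$ if the closest labeled box to its right is $\beta$; $q$ if it is $\delta$; and if it is $\alpha$ or $\gamma$, it contributes $1$ or $q$ according to whether the closest labeled box below it is in $\{\alpha,\delta\}$ or in $\{\beta,\gamma\}$. Let $t(T)$ be the number of diagonal boxes labeled $\alpha$ or $\delta$, and let $$Z_n(y;\alpha,\beta,\gamma,\delta;q)=\sum_{T\text{ of size }n}\mathrm{wt}(T)\,y^{t(T)} .$$ **Askey–Wilson polynomials and moments.** Let $(a;q)_n=\prod_{k=0}^{n-1}(1-aq^k)$ and $(a_1,\dots,a_s;q)_n=\prod_r(a_r;q)_n$, also for $n=\infty$ when $|q|<1$. With $x=\cos\theta=\frac{z+z^{-1}}2$, $z=e^{i\theta}$, put $$P_n(x;a,b,c,d|q)=a^{-n}(ab,ac,ad;q)_n\sum_{k=0}^n\frac{(q^{-n},q^{n-1}abcd,ae^{i\theta},ae^{-i\theta};q)_k}{(ab,ac,ad,q;q)_k}q^k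 ,$$ $$w(x;a,b,c,d|q)=\frac{(z^2,z^{-2};q)_\infty}{h_0\,(az,az^{-1},bz,bz^{-1},cz,cz^{-1},dz,dz^{-1};q)_\infty},\qquad h_0=\frac{(abcd;q)_\infty}{(q,ab,ac,ad,bc,bd,cd;q)_\infty}.$$ For $|q|,|a|,|b|,|c|,|d|<1$ and a polynomial $f$ let $$I_{a,b,c,d}(f)=\oint_{|z|=1}\frac{dz}{4\pi i z}\,w\Big(\frac{z+z^{-1}}2;a,b,c,d\Big|q\Big)f\Big(\frac{z+z^{-1}}2\Big),\qquad \mu_n(a,b,c,d|q)=I_{a,b,c,d}(x^n).$$ We say that a family $(p_m)_{m\ge0}$ of polynomials with complex coefficients has moments $(\mu_n)_{n\ge 0}$ if there is exactly one linear functional $L$ on $\mathbb C[x]$ with $L(1)=1$ and $L(p_m)=0$ for all $m\ge1$, and $L(x^n)=\mu_n$ for all $n$. (If $p_0=1$, this $L$ is the only normalized functional for which the family can be orthogonal.) Call $(a,b,c,d,q)\in\mathbb C^5$ generic if $a\ne0$, $q\neq 0$, $q^k\ne1$ for all $k\ge1$, and $abq^k,\ acq^k,\ adq^k,\ abcdq^k$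 are all different from $1$ for all $k\ge0$. **Theorem.** Let $a,b,c,d,q\in\mathbb C$. (1) Put $$\alpha=\tfrac{1-q}{1-ac+ai+ci},\quad \beta=\tfrac{1-q}{1-bd-bi-di},\quad \gamma=\tfrac{(1-q)ac}{1-ac+ai+ci},\quad \delta=\tfrac{(1-q)bd}{1-bd-bi-di}.$$ If $|q|,|a|,|b|,|c|,|d|<1$, then for all $n\ge0$ $$\mu_n(a,b,c,d|q)=\frac{(1-q)^n}{2^n i^n\prod_{j=0}^{n-1}(\alpha\beta-\gamma\delta q^j)}\,Z_n(-1;\alpha,\beta,\gamma,\delta;q).$$ If $(a,b,c,d,q)$ is generic and $1-ac+ai+ci\neq0\ne 1-bd-bi-di$, then the right-hand sides are the moments of the polynomials $P_m(x;a,b,c,d|q)$. (2) Let $y\in\mathbb C\setminus\{0\}$, let $\sqrt y$ be either square root of $y$, assume $1+ac+a+c\ne0\neq 1+bd+b+d$, and put $$\alpha=\tfrac{1-q}{1+ac+a+c},\quad \beta=\tfrac{1-q}{1+bd+b+d},\quad \gamma=\tfrac{-(1-q)ac}{1+ac+a+c},\quad \delta=\tfrac{-(1-q)bd}{1+bd+b+d}.$$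 If $|q|,|a/\sqrt y|,|b\sqrt y|,|c/\sqrt y|,|d\sqrt y|<1$, then for all $n\ge0$ $$I_{a/\sqrt y,\,b\sqrt y,\,c/\sqrt y,\,d\sqrt y}\big((2\sqrt y\,x+1+y)^n\big)=\frac{(1-q)^n}{\prod_{j=0}^{n-1}(\alpha\beta-\gamma\delta q^j)}\,Z_n(y;\alpha,\beta,\gamma,\delta;q).$$ If $(a/\sqrt y,b\sqrt y,c/\sqrt y,d\sqrt y,q)$ is generic, then the right-hand sides are the moments of the rescaled polynomials $P_m\big(\frac{x-1-y}{2\sqrt y};\frac a{\sqrt y},b\sqrt y,\frac c{\sqrt y},d\sqrt y\,\big|\,q\big)$. -/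

import Mathlib

open Polynomial

noncomputable section

/-! Staircase tableaux and their fugacity generating polynomial -/

inductive TabLabel where
  | alpha | beta | gamma | delta
  deriving DecidableEq

instance : Fintype TabLabel where
  elems := {.alpha, .beta, .gamma, .delta}
  complete := fun x => by cases x <;> simp

/-- The boxes of the Young diagram of shape `(n, n-1, ..., 2, 1)` in English convention: row `p.1`
(numbered from `0`, top to bottom) has the `n - p.1` boxes in the columns `p.2 = 0, ..., n-1-p.1`
(left to right). -/
abbrev StairBox (n : ℕ) : Type := {p : Fin n × Fin n // (p.1 : ℕ) + (p.2 : ℕ) < n}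

namespace StairBox

variable {n : ℕ}

def OnDiag (c : StairBox n) : Prop := (c.1.1 : ℕ) + (c.1.2 : ℕ) + 1 = n

/-- `c'` lies in the same row as `c`, strictly to its right. -/
def RightOf (c' c : StairBox n) : Prop := c'.1.1 = c.1.1 ∧ c.1.2 < c'.1.2

/-- `c'` lies in the same column as `c`, strictly below it. -/
def Below (c' c : StairBox n) : Prop := c'.1.2 = c.1.2 ∧ c.1.1 < c'.1.1

end StairBox

/-- A filling of the boxes; `none` is an empty box. -/
abbrev StairFilling (n : ℕ) : Type := StairBox n → Option TabLabel

namespace StairFilling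

variable {n : ℕ}

structure IsStaircaseTableau (T : StairFilling n) : Prop where
  diag_ne_empty : ∀ c : StairBox n, c.OnDiag → T c ≠ none
  left_empty : ∀ c c' : StairBox n, (T c' = some .beta ∨ T c' = some .delta) →
    c'.RightOf c → T c = none
  above_empty : ∀ c c' : StairBox n, (T c' = some .alpha ∨ T c' = some .gamma) →
    c'.Below c → T c = none

/-- The closest labeled box to the right of `c` in the same row carries the label `l`. -/
def SeesRight (T : StairFilling n) (c : StairBox n) (l : TabLabel) : Prop :=
  ∃ c' : StairBox n, c'.RightOf c ∧ T c' = some l ∧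
    ∀ c'' : StairBox n, c''.RightOf c → c'.RightOf c'' → T c'' = none

/-- The closest labeled box below `c` in the same column carries the label `l`. -/
def SeesBelow (T : StairFilling n) (c : StairBox n) (l : TabLabel) : Prop :=
  ∃ c' : StairBox n, c'.Below c ∧ T c' = some l ∧
    ∀ c'' : StairBox n, c''.Below c → c'.Below c'' → T c'' = none

open Classical in
/-- The factor that the box `c` contributes to the weight: its label if it is labeled; `u` or `q`
if it is blank (in a tableau a blank box that sees neither `β` nor `δ` to its right sees `α` or `γ`
there, and if it does not see `α` or `δ` below, then it sees `β` or `γ` there). -/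
def boxWeight (α β γ δ q u : ℂ) (T : StairFilling n) (c : StairBox n) : ℂ :=
  match T c with
  | some .alpha => α
  | some .beta => β
  | some .gamma => γ
  | some .delta => δ
  | none =>
    if T.SeesRight c .beta then u
    else if T.SeesRight c .delta then q
    else if T.SeesBelow c .alpha ∨ T.SeesBelow c .delta then u
    else q

def weight (α β γ δ q u : ℂ) (T : StairFilling n) : ℂ := ∏ c, T.boxWeight α β γ δ q u c

open Classical in
/-- `t(T)`: the number of black particles in the type of `T`, that is, of diagonal boxes labeled
`α` or `δ`. -/
def blackCount (T : StairFilling n) : ℕ :=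
  (Finset.univ.filter fun c : StairBox n =>
    c.OnDiag ∧ (T c = some .alpha ∨ T c = some .delta)).card

end StairFilling

open Classical in
/-- `Z_n(y; α, β, γ, δ; q)`, the sum of `wt(T) y^{t(T)}` (with `u = 1`) over all staircase tableaux
`T` of size `n`. -/
def fugacityZ (n : ℕ) (y α β γ δ q : ℂ) : ℂ :=
  ∑ T ∈ Finset.univ.filter (fun T : StairFilling n => T.IsStaircaseTableau),
    T.weight α β γ δ q 1 * y ^ T.blackCount

/-! Askey-Wilson weight function and moments -/

/-- `(a; q)_n` -/
def qPoch (a q : ℂ) (n : ℕ) : ℂ := ∏ k ∈ Finset.range n, (1 - a * q ^ k)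

/-- `(a; q)_∞`, used for `|q| < 1` -/
def qPochInf (a q : ℂ) : ℂ := ∏' k : ℕ, (1 - a * q ^ k)

/-- The normalization `h_0(a, b, c, d, q)`. -/
def awH0 (a b c d q : ℂ) : ℂ :=
  qPochInf (a * b * c * d) q /
    (qPochInf q q * qPochInf (a * b) q * qPochInf (a * c) q * qPochInf (a * d) q *
      qPochInf (b * c) q * qPochInf (b * d) q * qPochInf (c * d) q)

/-- The Askey-Wilson weight `w((z + z⁻¹) / 2)`, normalized by `h_0`, as a function of
`z = e^{iθ}`. -/
def awWeight (a b c d q z : ℂ) : ℂ :=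
  (qPochInf (z ^ 2) q * qPochInf ((z⁻¹) ^ 2) q) /
    (awH0 a b c d q *
      (qPochInf (a * z) q * qPochInf (a * z⁻¹) q * qPochInf (b * z) q * qPochInf (b * z⁻¹) q *
        qPochInf (c * z) q * qPochInf (c * z⁻¹) q * qPochInf (d * z) q * qPochInf (d * z⁻¹) q))

/-- The integral of `w(x) f(x)`, `x = (z + z⁻¹) / 2`, against `dz / (4π i z)` over the unit circle.
For `|q|, |a|, |b|, |c|, |d| < 1` the unit circle encloses the poles `a q^k, b q^k, c q^k, d q^k`
and excludes their inverses. -/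
def awIntegral (a b c d q : ℂ) (f : ℂ → ℂ) : ℂ :=
  ∮ z in C(0, 1),
    (4 * (Real.pi : ℂ) * Complex.I * z)⁻¹ * (awWeight a b c d q z * f ((z + z⁻¹) / 2))

/-- The moment `μ_n(a, b, c, d | q)` for `|q|, |a|, |b|, |c|, |d| < 1`. -/
def awMoment (n : ℕ) (a b c d q : ℂ) : ℂ := awIntegral a b c d q (fun x => x ^ n)

/-! Askey-Wilson polynomials and the moments of a family of polynomials -/

/-- `(a e^{iθ}, a e^{-iθ}; q)_k` as a polynomial in `x = cos θ`. -/
def awPhi (a q : ℂ) (k : ℕ) : ℂ[X] :=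
  ∏ j ∈ Finset.range k, (1 - C (2 * a * q ^ j) * X + C (a ^ 2 * q ^ (2 * j)))

/-- The Askey-Wilson polynomial `P_n(x; a, b, c, d | q)`. -/
def awPoly (a b c d q : ℂ) (n : ℕ) : ℂ[X] :=
  C ((a ^ n)⁻¹ * (qPoch (a * b) q n * qPoch (a * c) q n * qPoch (a * d) q n)) *
    ∑ k ∈ Finset.range (n + 1),
      C ((qPoch (q ^ (-(n : ℤ))) q k * qPoch (q ^ ((n : ℤ) - 1) * (a * b * c * d)) q k) /
          (qPoch (a * b) q k * qPoch (a * c) q k * qPoch (a * d) q k * qPoch q q k) * q ^ k) *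
        awPhi a q k

/-- `L` is a normalized functional that annihilates `p 1, p 2, ...`. When `p 0 = 1`, every
normalized functional for which the family `p` is orthogonal has this property, and when moreover
`p m` has degree `m`, there is only one functional with this property. -/
def IsMomentFunctional (p : ℕ → ℂ[X]) (L : ℂ[X] →ₗ[ℂ] ℂ) : Prop :=
  L 1 = 1 ∧ ∀ m : ℕ, m ≠ 0 → L (p m) = 0

/-- The family `p` determines its moment functional, and the moments are `μ 0, μ 1, ...`. -/
def HasMoments (p : ℕ → ℂ[X]) (μ : ℕ → ℂ) : Prop :=
  (∃! L : ℂ[X] →ₗ[ℂ] ℂ, IsMomentFunctional p L) ∧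
    ∀ L : ℂ[X] →ₗ[ℂ] ℂ, IsMomentFunctional p L → ∀ n : ℕ, L (X ^ n) = μ n

/-- The parameters for which every `P_n(x; a, b, c, d | q)` is given by its explicit formula
(no denominator vanishes) and has degree exactly `n`. -/
structure AWGeneric (a b c d q : ℂ) : Prop where
  q_ne_zero : q ≠ 0
  q_pow : ∀ k : ℕ, 1 ≤ k → q ^ k ≠ 1
  a_ne_zero : a ≠ 0
  ab : ∀ k : ℕ, a * b * q ^ k ≠ 1
  ac : ∀ k : ℕ, a * c * q ^ k ≠ 1
  ad : ∀ k : ℕ, a * d * q ^ k ≠ 1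
  abcd : ∀ k : ℕ, a * b * c * d * q ^ k ≠ 1

end

/-!
Both sides are the values of one linear functional, the Askey-Wilson functional `awL`, at the powers
of a linear polynomial.

*The functional.* Let `d` be multiplication by `X` on `ℂ[X]` and let `e = oscE a c q` satisfy
`e d = q d e + (1 - q)` and `e 1 = (a + c) - a c X`. If `a b c d qᵏ ≠ 1` for all `k`, there is a
unique normalized functional `vacF` with `vacF ∘ (d + b d e) = (b + d) vacF` (the scalars `b`, `d`
here are the parameters), and `awL f = vacF (f ((d + e) / 2) 1)`. Multiplication by `1 - a X`
intertwines the modules for `a q` and `a` (`aeval_oscX_intertwine`), which gives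
`awL ((1 - 2 a x + a²) f)` as a multiple of the functional for `a q`, and so the values at the basis
`awPhi a q k` (`awL_awPhi`). A summation formula (`sum_range_phi21`) then shows that `awL`
annihilates the Askey-Wilson polynomials of positive degree, and it is the only normalized
functional that does (`AWGeneric.hasMoments_comp`).

*The tableaux.* Let `D`, `E`, `W`, `V` solve the matrix ansatz `E D = q D E + D + E`,
`α E W = γ D W + W`, `V (β D - δ E) = V`, `V W = 1`. A tableau is built by adding columns on the
left, and the weight of a new column depends on the rest only through the leftmost label in each
row. Mark a row whose leftmost label is `α` or `γ` (these are the rows that a new column can still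
use) by the operator `β D - t δ E`, a row with leftmost label `δ` by `t` and one with `β` by `1`.
The sum over the tableaux of size `n`, each with the product of its marks applied to `W`, satisfies
a recursion in `n`: adding a column replaces `t` by `q t` and contributes
`(α β - γ δ t) (y D + E)` (`MatrixAnsatz.markVec_colSum`). At `t = 1` the functional `V` absorbs
all the marks, so that
`Z_n = ∏ (α β - γ δ qʲ) V ((y D + E)ⁿ W)` (`MatrixAnsatz.fugacityZ_eq`). The oscillator
module solves the ansatz with `D = (1 + d / s) / (1 - q)` and `E = (1 + s e) / (1 - q)`
(`matrixAnsatz_osc`), for which `(1 - q) (s² D + E) = 1 + s² + s (d + e)`; this identifies the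
tableau side with `awL` (`awL_eq_fugacityZ`).

*The integral.* Multiplying the weight by `1 - 2 a x + a²` gives the weight for `a q` up to a
constant (`awIntegral_shift`), the same rule as for `awL`, so what remains is that the weight has
total mass `1`. A rational multiple of the weight is a difference `H(z) - H(q z)` with `H` analytic
on the annulus `|q| ≤ |z| ≤ 1`, so Cauchy's theorem evaluates the first moment in terms of the
total mass. Together with the shift this makes the total mass invariant under `a ↦ a q`, hence,
by continuity, under `a ↦ 0`. By symmetry it does not depend on the parameters `a`, `b`, `c`, `d`
at all, and at `(q, -q, r, -r)` with `r² = q` the weight is elementary (`awIntegral_one_special`).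
The excluded values `a = 0` and `q = 0` are reached by continuity (`InDisc.integralL_eq`).
-/

/-! ### The `q`-oscillator module -/

/-- The action of the letter `e` on `ℂ[X]`, regarded as the cyclic right module generated by `1` over
the `q`-oscillator algebra `d e - q e d = 1 - q`, in which `d` acts as multiplication by `X` and the
generator satisfies `1 · (e + a c d) = a + c`. For `k = 0` the truncated exponent `k - 1` is harmless,
since its coefficient vanishes. -/
noncomputable def oscE (a c q : ℂ) : ℂ[X] →ₗ[ℂ] ℂ[X] :=
  (basisMonomials ℂ).constr ℂ fun k =>
    C (q ^ k * (a + c)) * X ^ k - C (q ^ k * (a * c)) * X ^ (k + 1) + C (1 - q ^ k) * X ^ (k - 1)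

lemma oscE_X_pow (a c q : ℂ) (k : ℕ) : oscE a c q (X ^ k) =
    C (q ^ k * (a + c)) * X ^ k - C (q ^ k * (a * c)) * X ^ (k + 1) + C (1 - q ^ k) * X ^ (k - 1) := by
  have h : (X ^ k : ℂ[X]) = basisMonomials ℂ k := by
    rw [coe_basisMonomials, ← monomial_one_right_eq_X_pow]
  rw [oscE]
  conv_lhs => rw [h]
  rw [Module.Basis.constr_basis]

lemma oscE_one (a c q : ℂ) : oscE a c q 1 = C (a + c) - C (a * c) * X := by
  simpa using oscE_X_pow a c q 0

/-- Two linear maps on `ℂ[X]` that agree on the powers of `X` are equal. -/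
lemma linearMap_ext_X_pow {M : Type*} [AddCommMonoid M] [Module ℂ M] {f g : ℂ[X] →ₗ[ℂ] M}
    (h : ∀ k : ℕ, f (X ^ k) = g (X ^ k)) : f = g := by
  refine (basisMonomials ℂ).ext fun k => ?_
  simpa only [coe_basisMonomials, monomial_one_right_eq_X_pow] using h k

lemma oscE_X_mul (a c q : ℂ) (p : ℂ[X]) :
    oscE a c q (X * p) = q • (X * oscE a c q p) + (1 - q) • p := by
  have h : oscE a c q ∘ₗ LinearMap.mulLeft ℂ (X : ℂ[X]) =
      q • (LinearMap.mulLeft ℂ (X : ℂ[X]) ∘ₗ oscE a c q) + (1 - q) • LinearMap.id := by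
    refine linearMap_ext_X_pow fun k => ?_
    simp only [LinearMap.comp_apply, LinearMap.mulLeft_apply, LinearMap.add_apply,
      LinearMap.smul_apply, LinearMap.id_apply, smul_eq_C_mul]
    rw [← pow_succ', oscE_X_pow, oscE_X_pow]
    cases k with
    | zero => simp; ring
    | succ k =>
      simp only [Nat.add_sub_cancel, map_sub, map_mul, map_pow, map_add, map_one]
      ring
  exact LinearMap.congr_fun h p

/-- Multiplication by `1 - a X` intertwines the modules with parameters `a q` and `a`. -/
lemma oscE_intertwine (a c q : ℂ) (p : ℂ[X]) :
    oscE a c q ((1 - C a * X) * p) = (1 - C a * X) * oscE (a * q) c q p := by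
  have h : oscE a c q ∘ₗ LinearMap.mulLeft ℂ (1 - C a * X : ℂ[X]) =
      LinearMap.mulLeft ℂ (1 - C a * X : ℂ[X]) ∘ₗ oscE (a * q) c q := by
    refine linearMap_ext_X_pow fun k => ?_
    simp only [LinearMap.comp_apply, LinearMap.mulLeft_apply]
    have h1 : (1 - C a * X : ℂ[X]) * X ^ k = X ^ k - a • X ^ (k + 1) := by
      rw [smul_eq_C_mul]; ring
    rw [h1, map_sub, map_smul, smul_eq_C_mul, oscE_X_pow, oscE_X_pow, oscE_X_pow]
    cases k with
    | zero => simp; ring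
    | succ k =>
      simp only [Nat.add_sub_cancel, map_sub, map_mul, map_pow, map_add, map_one]
      ring
  exact LinearMap.congr_fun h p

/-- The values at the powers of `X` of the right vacuum functional `vacF`. -/
noncomputable def vacSeq (a b c d q : ℂ) : ℕ → ℂ
  | 0 => 1
  | 1 => (b + d - b * d * (a + c)) / (1 - a * b * c * d)
  | k + 2 => ((b + d - b * d * (q ^ (k + 1) * (a + c))) * vacSeq a b c d q (k + 1) -
      b * d * (1 - q ^ (k + 1)) * vacSeq a b c d q k) / (1 - a * b * c * d * q ^ (k + 1))

/-- The right vacuum: the functional on the oscillator module that sends `1` to `1` and satisfies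
`(d + b d e) |V⟩ = (b + d) |V⟩`, see `vacF_right`. -/
noncomputable def vacF (a b c d q : ℂ) : ℂ[X] →ₗ[ℂ] ℂ :=
  (basisMonomials ℂ).constr ℂ (vacSeq a b c d q)

lemma vacF_X_pow (a b c d q : ℂ) (k : ℕ) : vacF a b c d q (X ^ k) = vacSeq a b c d q k := by
  have h : (X ^ k : ℂ[X]) = basisMonomials ℂ k := by
    rw [coe_basisMonomials, ← monomial_one_right_eq_X_pow]
  rw [vacF]
  conv_lhs => rw [h]
  rw [Module.Basis.constr_basis]

lemma vacF_one (a b c d q : ℂ) : vacF a b c d q 1 = 1 := by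
  simpa [vacSeq] using vacF_X_pow a b c d q 0

/-- The right boundary equation on powers of `X`, for an arbitrary functional. -/
lemma map_X_pow_succ_of_right {a b c d q : ℂ} (U : ℂ[X] →ₗ[ℂ] ℂ) (k : ℕ) :
    U (X * X ^ k) + b * d * U (oscE a c q (X ^ k)) - (b + d) * U (X ^ k) =
      (1 - a * b * c * d * q ^ k) * U (X ^ (k + 1)) -
        ((b + d - b * d * (q ^ k * (a + c))) * U (X ^ k) -
          b * d * (1 - q ^ k) * U (X ^ (k - 1))) := by
  rw [oscE_X_pow, ← pow_succ', ← smul_eq_C_mul, ← smul_eq_C_mul, ← smul_eq_C_mul]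
  simp only [map_add, map_sub, map_smul, smul_eq_mul]
  ring

lemma vacF_right {a b c d q : ℂ} (h : ∀ k : ℕ, a * b * c * d * q ^ k ≠ 1) (p : ℂ[X]) :
    vacF a b c d q (X * p) + b * d * vacF a b c d q (oscE a c q p) =
      (b + d) * vacF a b c d q p := by
  have h0 : vacF a b c d q ∘ₗ LinearMap.mulLeft ℂ (X : ℂ[X]) +
      (b * d) • (vacF a b c d q ∘ₗ oscE a c q) = (b + d) • vacF a b c d q := by
    refine linearMap_ext_X_pow fun k => ?_
    simp only [LinearMap.comp_apply, LinearMap.mulLeft_apply, LinearMap.add_apply,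
      LinearMap.smul_apply, smul_eq_mul]
    rw [← sub_eq_zero, map_X_pow_succ_of_right, sub_eq_zero]
    have hk : 1 - a * b * c * d * q ^ k ≠ 0 := fun e => h k (sub_eq_zero.mp e).symm
    cases k with
    | zero =>
      simp only [pow_zero, mul_one] at hk
      rw [vacF_X_pow, vacF_X_pow]
      simp only [vacSeq, pow_zero, mul_one]
      field_simp
      ring
    | succ k =>
      simp only [vacF_X_pow, vacSeq, Nat.add_sub_cancel]
      field_simp
  exact LinearMap.congr_fun h0 p

/-- The right boundary equation determines the functional up to a scalar. -/
lemma eq_smul_vacF_of_right {a b c d q : ℂ} (h : ∀ k : ℕ, a * b * c * d * q ^ k ≠ 1)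
    (U : ℂ[X] →ₗ[ℂ] ℂ)
    (hU : ∀ p, U (X * p) + b * d * U (oscE a c q p) = (b + d) * U p) (p : ℂ[X]) :
    U p = U 1 * vacF a b c d q p := by
  have hs : ∀ k : ℕ, U (X ^ k) = U 1 * vacF a b c d q (X ^ k) := by
    intro k
    induction k using Nat.strong_induction_on with
    | _ k ih =>
      cases k with
      | zero => simp [vacF_one]
      | succ k =>
        have hk : 1 - a * b * c * d * q ^ k ≠ 0 := fun e => h k (sub_eq_zero.mp e).symm
        have e1 := map_X_pow_succ_of_right (a := a) (b := b) (c := c) (d := d) (q := q) U k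
        have e2 := map_X_pow_succ_of_right (a := a) (b := b) (c := c) (d := d) (q := q)
          (vacF a b c d q) k
        rw [hU, sub_self] at e1
        rw [vacF_right h, sub_self] at e2
        have i1 := ih k (by omega)
        have i2 := ih (k - 1) (by omega)
        apply mul_left_cancel₀ hk
        rw [i1, i2] at e1
        linear_combination U 1 * e2 - e1
  have h0 : U = U 1 • vacF a b c d q := linearMap_ext_X_pow fun k => by
    simpa using hs k
  exact LinearMap.congr_fun h0 p

/-- The image of `cos θ`: the operator `(d + e) / 2`. -/
noncomputable def oscX (a c q : ℂ) : ℂ[X] →ₗ[ℂ] ℂ[X] :=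
  (2 : ℂ)⁻¹ • (LinearMap.mulLeft ℂ (X : ℂ[X]) + oscE a c q)

/-- The functional `f ↦ ⟨W| f((d + e) / 2) |V⟩`, the algebraic form of the integral against the
Askey-Wilson weight. -/
noncomputable def awL (a b c d q : ℂ) : ℂ[X] →ₗ[ℂ] ℂ :=
  vacF a b c d q ∘ₗ LinearMap.applyₗ (1 : ℂ[X]) ∘ₗ (aeval (R := ℂ) (oscX a c q)).toLinearMap

lemma awL_apply (a b c d q : ℂ) (f : ℂ[X]) :
    awL a b c d q f = vacF a b c d q (aeval (oscX a c q) f 1) := rfl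

lemma awL_one (a b c d q : ℂ) : awL a b c d q 1 = 1 := by
  simp [awL_apply, vacF_one]

lemma aeval_oscX_intertwine (a c q : ℂ) (f p : ℂ[X]) :
    aeval (oscX a c q) f ((1 - C a * X) * p) =
      (1 - C a * X) * aeval (oscX (a * q) c q) f p := by
  induction f using Polynomial.induction_on' generalizing p with
  | add f g hf hg => simp only [map_add, LinearMap.add_apply, hf, hg, mul_add]
  | monomial n r =>
    simp only [aeval_monomial, Module.End.mul_apply, Module.algebraMap_end_apply]
    rw [mul_smul_comm]
    congr 1
    induction n generalizing p with
    | zero => simp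
    | succ n ih =>
      rw [pow_succ, pow_succ, Module.End.mul_apply, Module.End.mul_apply, ← ih]
      congr 1
      simp only [oscX, LinearMap.smul_apply, LinearMap.add_apply, LinearMap.mulLeft_apply,
        oscE_intertwine, mul_smul_comm]
      ring_nf

/-- The factor `1 - 2 a x + a²` shifts the parameter `a` to `a q`. -/
lemma awL_shift {a b c d q : ℂ} (h : ∀ k : ℕ, a * b * c * d * q ^ k ≠ 1) (f : ℂ[X]) :
    awL a b c d q ((1 - C (2 * a) * X + C (a ^ 2)) * f) =
      (1 - a * b) * (1 - a * c) * (1 - a * d) / (1 - a * b * c * d) * awL (a * q) b c d q f := by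
  have h' : ∀ k : ℕ, a * q * b * c * d * q ^ k ≠ 1 := fun k => by
    convert h (k + 1) using 1; ring
  have h0 : 1 - a * b * c * d ≠ 0 := fun e => h 0 (by simpa using (sub_eq_zero.mp e).symm)
  have e1 : aeval (oscX a c q) (1 - C (2 * a) * X + C (a ^ 2) : ℂ[X]) (1 : ℂ[X]) =
      (1 - a * c) • ((1 - C a * X) * 1) := by
    rw [sq, C_mul]
    simp only [map_add, map_sub, map_mul, aeval_X, aeval_C, map_one, LinearMap.add_apply,
      LinearMap.sub_apply, Module.End.mul_apply, Module.algebraMap_end_apply, oscX,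
      LinearMap.smul_apply, LinearMap.mulLeft_apply, oscE_one, Module.End.one_apply,
      smul_eq_C_mul]
    have : (C (2 : ℂ) * C (2 : ℂ)⁻¹ : ℂ[X]) = 1 := by rw [← C_mul]; simp
    linear_combination (-C a * (X + C a + C c - C a * C c * X)) * this
  have e2 : ∀ p, vacF a b c d q ((1 - C a * X) * p) =
      (1 - a * b) * (1 - a * d) / (1 - a * b * c * d) * vacF (a * q) b c d q p := by
    intro p
    have := eq_smul_vacF_of_right h' (vacF a b c d q ∘ₗ LinearMap.mulLeft ℂ (1 - C a * X : ℂ[X]))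
      (fun p => by
        simp only [LinearMap.comp_apply, LinearMap.mulLeft_apply]
        rw [← vacF_right h, oscE_intertwine]
        congr 2
        ring) p
    simp only [LinearMap.comp_apply, LinearMap.mulLeft_apply] at this
    rw [this, mul_one]
    congr 1
    have hX : vacF a b c d q X = vacSeq a b c d q 1 := by simpa using vacF_X_pow a b c d q 1
    rw [map_sub, vacF_one, ← smul_eq_C_mul, map_smul, hX, vacSeq, smul_eq_mul]
    rw [eq_div_iff h0, sub_mul, mul_assoc a (_ / _), div_mul_cancel₀ _ h0]
    ring
  rw [awL_apply, mul_comm, map_mul, Module.End.mul_apply, e1, map_smul, map_smul,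
    aeval_oscX_intertwine, e2, awL_apply, smul_eq_mul]
  ring

lemma awPhi_succ (a q : ℂ) (k : ℕ) :
    awPhi a q (k + 1) = (1 - C (2 * a) * X + C (a ^ 2)) * awPhi (a * q) q k := by
  rw [awPhi, Finset.prod_range_succ', mul_comm]
  congr 1
  · simp
  · refine Finset.prod_congr rfl fun j _ => ?_
    rw [show 2 * a * q ^ (j + 1) = 2 * (a * q) * q ^ j by ring,
      show a ^ 2 * q ^ (2 * (j + 1)) = (a * q) ^ 2 * q ^ (2 * j) by ring]

lemma qPoch_succ' (a q : ℂ) (k : ℕ) : qPoch a q (k + 1) = (1 - a) * qPoch (a * q) q k := by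
  rw [qPoch, Finset.prod_range_succ', mul_comm]
  congr 1
  · simp
  · exact Finset.prod_congr rfl fun j _ => by ring

lemma qPoch_zero (a q : ℂ) : qPoch a q 0 = 1 := rfl

lemma qPoch_succ (a q : ℂ) (k : ℕ) : qPoch a q (k + 1) = qPoch a q k * (1 - a * q ^ k) :=
  Finset.prod_range_succ _ _

lemma awL_awPhi {a b c d q : ℂ} (h : ∀ k : ℕ, a * b * c * d * q ^ k ≠ 1) (k : ℕ) :
    awL a b c d q (awPhi a q k) =
      qPoch (a * b) q k * qPoch (a * c) q k * qPoch (a * d) q k / qPoch (a * b * c * d) q k := by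
  induction k generalizing a with
  | zero => simp [awPhi, qPoch_zero, awL_one]
  | succ k ih =>
    have h' : ∀ k : ℕ, a * q * b * c * d * q ^ k ≠ 1 := fun k => by
      convert h (k + 1) using 1; ring
    rw [awPhi_succ, awL_shift h, ih h', qPoch_succ', qPoch_succ', qPoch_succ', qPoch_succ',
      div_mul_div_comm]
    congr 1 <;> ring_nf

/-! ### Moments of the Askey-Wilson polynomials -/

/-- Closed form of the partial sums of `₂φ₁(A, B; A B q; q, q)`. -/
lemma sum_range_phi21 {A B q : ℂ} (m : ℕ) (hq : ∀ k : ℕ, 1 ≤ k → q ^ k ≠ 1)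
    (hAB : ∀ k : ℕ, A * B * q * q ^ k ≠ 1) :
    ∑ k ∈ Finset.range (m + 1),
        qPoch A q k * qPoch B q k / (qPoch (A * B * q) q k * qPoch q q k) * q ^ k =
      qPoch (A * q) q m * qPoch (B * q) q m / (qPoch (A * B * q) q m * qPoch q q m) := by
  have h1 : ∀ k, qPoch q q k ≠ 0 := fun k => by
    refine Finset.prod_ne_zero_iff.mpr fun j _ e => hq (j + 1) (by omega) ?_
    rw [pow_succ']; exact (sub_eq_zero.mp e).symm
  have h2 : ∀ k, qPoch (A * B * q) q k ≠ 0 := fun k =>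
    Finset.prod_ne_zero_iff.mpr fun j _ e => hAB j (sub_eq_zero.mp e).symm
  induction m with
  | zero => simp [qPoch_zero]
  | succ m ih =>
    rw [Finset.sum_range_succ, ih, qPoch_succ' A, qPoch_succ' B, qPoch_succ (A * q),
      qPoch_succ (B * q), qPoch_succ (A * B * q), qPoch_succ q]
    have h3 : 1 - q * q ^ m ≠ 0 := fun e => hq (m + 1) (by omega) (by
      rw [pow_succ']; exact (sub_eq_zero.mp e).symm)
    have h4 : 1 - A * q * B * q ^ m ≠ 0 := fun e =>
      hAB m (by linear_combination -e)
    have h5 := h1 m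
    have h6 := h2 m
    rw [pow_succ]
    generalize q ^ m = t at *
    generalize qPoch q q m = u1 at *
    generalize qPoch (A * B * q) q m = u2 at *
    field_simp
    ring

lemma natDegree_awPhi_le (a q : ℂ) (k : ℕ) : (awPhi a q k).natDegree ≤ k := by
  rw [awPhi]
  refine (natDegree_prod_le _ _).trans ?_
  refine (Finset.sum_le_card_nsmul _ _ 1 fun j _ => ?_).trans (by simp)
  compute_degree

lemma coeff_awPhi (a q : ℂ) (k : ℕ) :
    (awPhi a q k).coeff k = ∏ j ∈ Finset.range k, -(2 * a * q ^ j) := by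
  have := coeff_prod_of_natDegree_le (s := Finset.range k)
    (f := fun j => (1 - C (2 * a * q ^ j) * X + C (a ^ 2 * q ^ (2 * j)) : ℂ[X])) (n := 1)
    (fun j _ => by compute_degree)
  rw [Finset.card_range, mul_one] at this
  rw [awPhi, this]
  refine Finset.prod_congr rfl fun j _ => ?_
  simp only [coeff_add, coeff_sub, coeff_C_mul, coeff_X_one, coeff_C_succ, coeff_one]
  simp

/-- Functionals that agree on `awPhi a q k` for all `k` are equal: `awPhi a q k` has degree `k`. -/
lemma eq_of_awPhi {a q : ℂ} (ha : a ≠ 0) (hq : q ≠ 0) {L L' : ℂ[X] →ₗ[ℂ] ℂ}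
    (h : ∀ k, L (awPhi a q k) = L' (awPhi a q k)) : L = L' := by
  have hc : ∀ k, (awPhi a q k).coeff k ≠ 0 := fun k => by
    rw [coeff_awPhi]
    exact Finset.prod_ne_zero_iff.mpr fun j _ => by simp [ha, hq]
  let S : Polynomial.Sequence ℂ :=
    ⟨awPhi a q, fun k => by
      rw [degree_eq_natDegree fun e => hc k (by simp [e])]
      exact congrArg _ (le_antisymm (natDegree_awPhi_le a q k) (le_natDegree_of_ne_zero (hc k)))⟩
  have hS := S.span fun k => isUnit_iff_ne_zero.mpr (leadingCoeff_ne_zero.mpr (S.ne_zero k))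
  refine LinearMap.ext_on hS ?_
  rintro _ ⟨k, rfl⟩
  exact h k

lemma qPoch_ne_zero {A q : ℂ} (n : ℕ) (h : ∀ k < n, A * q ^ k ≠ 1) : qPoch A q n ≠ 0 :=
  Finset.prod_ne_zero_iff.mpr fun k hk e =>
    h k (Finset.mem_range.mp hk) (sub_eq_zero.mp e).symm

lemma AWGeneric.eq_of_awPoly {a b c d q : ℂ} (h : AWGeneric a b c d q) {L L' : ℂ[X] →ₗ[ℂ] ℂ}
    (hL : ∀ m, L (awPoly a b c d q m) = L' (awPoly a b c d q m)) : L = L' := by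
  refine eq_of_awPhi h.a_ne_zero h.q_ne_zero (q := q) fun n => ?_
  induction n using Nat.strong_induction_on with
  | _ n ih =>
    have hn := hL n
    simp only [awPoly, ← smul_eq_C_mul, map_smul, map_sum, smul_eq_mul] at hn
    have h1 : (a ^ n)⁻¹ * (qPoch (a * b) q n * qPoch (a * c) q n * qPoch (a * d) q n) ≠ 0 :=
      mul_ne_zero (inv_ne_zero (pow_ne_zero _ h.a_ne_zero))
        (mul_ne_zero (mul_ne_zero (qPoch_ne_zero _ fun k _ => h.ab k)
          (qPoch_ne_zero _ fun k _ => h.ac k)) (qPoch_ne_zero _ fun k _ => h.ad k))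
    have hn := mul_left_cancel₀ h1 hn
    rw [Finset.sum_range_succ, Finset.sum_range_succ,
      Finset.sum_congr rfl fun k hk => by rw [ih k (Finset.mem_range.mp hk)],
      add_right_inj] at hn
    refine mul_left_cancel₀ (mul_ne_zero (div_ne_zero (mul_ne_zero ?_ ?_) ?_)
      (pow_ne_zero _ h.q_ne_zero)) hn
    · refine qPoch_ne_zero _ fun k hk e => h.q_pow (n - k) (by omega) ?_
      rw [← zpow_natCast, ← zpow_add₀ h.q_ne_zero,
        show -(n : ℤ) + k = -((n - k : ℕ) : ℤ) by omega, zpow_neg, inv_eq_one, zpow_natCast] at e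
      exact e
    · refine qPoch_ne_zero _ fun k hk e => h.abcd (n - 1 + k) ?_
      rw [show (n : ℤ) - 1 = ((n - 1 : ℕ) : ℤ) by omega, zpow_natCast] at e
      rw [pow_add, ← e]; ring
    · refine mul_ne_zero (mul_ne_zero (mul_ne_zero (qPoch_ne_zero _ fun k _ => h.ab k)
        (qPoch_ne_zero _ fun k _ => h.ac k)) (qPoch_ne_zero _ fun k _ => h.ad k))
        (qPoch_ne_zero _ fun k _ e => h.q_pow (k + 1) (by omega) ?_)
      rw [pow_succ', e]

/-- The functional `awL` annihilates the Askey-Wilson polynomials of positive degree, by the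
`q`-Chu-Vandermonde sum. -/
lemma AWGeneric.awL_awPoly {a b c d q : ℂ} (h : AWGeneric a b c d q) {m : ℕ} (hm : m ≠ 0) :
    awL a b c d q (awPoly a b c d q m) = 0 := by
  obtain ⟨n, rfl⟩ := Nat.exists_eq_succ_of_ne_zero hm
  have hq : q ^ n ≠ 0 := pow_ne_zero _ h.q_ne_zero
  have hA : q ^ (-((n + 1 : ℕ) : ℤ)) * q ^ (n + 1) = 1 := by
    rw [← zpow_natCast, ← zpow_add₀ h.q_ne_zero]; simp
  have hB : q ^ (((n + 1 : ℕ) : ℤ) - 1) = q ^ n := by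
    rw [← zpow_natCast]; congr 1; push_cast; ring
  have hAB : q ^ (-((n + 1 : ℕ) : ℤ)) * (q ^ n * (a * b * c * d)) * q = a * b * c * d := by
    linear_combination (a * b * c * d) * hA
  have key := sum_range_phi21 (A := q ^ (-((n + 1 : ℕ) : ℤ)))
    (B := q ^ n * (a * b * c * d)) (q := q) (n + 1) h.q_pow (by rw [hAB]; exact h.abcd)
  have hz : qPoch (q ^ (-((n + 1 : ℕ) : ℤ)) * q) q (n + 1) = 0 := by
    refine Finset.prod_eq_zero (Finset.self_mem_range_succ n) ?_
    linear_combination -hA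
  rw [hz, zero_mul, zero_div, hAB] at key
  simp only [awPoly, ← smul_eq_C_mul, map_smul, map_sum, smul_eq_mul, awL_awPhi h.abcd, hB]
  refine mul_eq_zero_of_right _ (Eq.trans (Finset.sum_congr rfl fun k _ => ?_) key)
  have h1 := qPoch_ne_zero k fun k _ => h.ab k
  have h2 := qPoch_ne_zero k fun k _ => h.ac k
  have h3 := qPoch_ne_zero k fun k _ => h.ad k
  have h4 := qPoch_ne_zero k fun k _ => h.abcd k
  have h5 : qPoch q q k ≠ 0 := qPoch_ne_zero k fun k _ e => h.q_pow (k + 1) (by omega) (by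
    rw [pow_succ', e])
  field_simp

lemma awPoly_zero (a b c d q : ℂ) : awPoly a b c d q 0 = 1 := by
  simp [awPoly, awPhi, qPoch_zero]

/-- The moments of the family of Askey-Wilson polynomials, rescaled by `x = u ξ + v`. -/
lemma AWGeneric.hasMoments_comp {a b c d q u v : ℂ} (h : AWGeneric a b c d q) (hu : u ≠ 0)
    {μ : ℕ → ℂ} (hμ : ∀ n, awL a b c d q ((C u * X + C v) ^ n) = μ n) :
    HasMoments (fun m => (awPoly a b c d q m).comp (C u⁻¹ * (X - C v))) μ := by
  have hcomp : ∀ p : ℂ[X], (p.comp (C u⁻¹ * (X - C v))).comp (C u * X + C v) = p := fun p => by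
    rw [comp_assoc]
    simp only [mul_comp, sub_comp, C_comp, X_comp, add_sub_cancel_right]
    rw [← mul_assoc, ← C_mul, inv_mul_cancel₀ hu, C_1, one_mul, comp_X]
  have hcomp' : ∀ p : ℂ[X], (p.comp (C u * X + C v)).comp (C u⁻¹ * (X - C v)) = p := fun p => by
    rw [comp_assoc]
    simp only [mul_comp, add_comp, C_comp, X_comp]
    rw [← mul_assoc, ← C_mul, mul_inv_cancel₀ hu, C_1, one_mul, sub_add_cancel, comp_X]
  -- substitution of `g` for the variable, as a linear map
  let S : ℂ[X] → ℂ[X] →ₗ[ℂ] ℂ[X] := fun g => (aeval (R := ℂ) g).toLinearMap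
  have hS : ∀ g p, S g p = p.comp g := fun g p => rfl
  have hL₀ : IsMomentFunctional (fun m => (awPoly a b c d q m).comp (C u⁻¹ * (X - C v)))
      (awL a b c d q ∘ₗ S (C u * X + C v)) := by
    refine ⟨?_, fun m hm => ?_⟩
    · rw [LinearMap.comp_apply, hS, one_comp, awL_one]
    · rw [LinearMap.comp_apply, hS, hcomp, h.awL_awPoly hm]
  have huniq : ∀ L, IsMomentFunctional (fun m => (awPoly a b c d q m).comp (C u⁻¹ * (X - C v))) L →
      L = awL a b c d q ∘ₗ S (C u * X + C v) := by
    intro L hL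
    have h1 : L ∘ₗ S (C u⁻¹ * (X - C v)) = awL a b c d q := by
      refine h.eq_of_awPoly fun m => ?_
      rw [LinearMap.comp_apply, hS]
      rcases eq_or_ne m 0 with rfl | hm
      · rw [awPoly_zero, one_comp, hL.1, awL_one]
      · rw [hL.2 m hm, h.awL_awPoly hm]
    refine LinearMap.ext fun p => ?_
    rw [← h1, LinearMap.comp_apply, LinearMap.comp_apply, hS, hS, hcomp']
  refine ⟨⟨_, hL₀, huniq⟩, fun L hL n => ?_⟩
  rw [huniq L hL, LinearMap.comp_apply, hS, X_pow_comp, hμ]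

/-! ### Staircase tableaux, column by column -/

namespace StairBox

variable {n : ℕ}

/-- The boxes outside the leftmost column of a staircase of size `n + 1` form a staircase of
size `n`. -/
def shift (b : StairBox n) : StairBox (n + 1) :=
  ⟨(b.1.1.castSucc, b.1.2.succ), by have := b.2; simp; omega⟩

/-- The boxes of the leftmost column. -/
def col (i : Fin (n + 1)) : StairBox (n + 1) := ⟨(i, 0), by have := i.2; simp; omega⟩

lemma bijective_elim_shift_col :
    Function.Bijective (Sum.elim (shift (n := n)) (col (n := n))) := by
  constructor
  · rintro (⟨⟨i, j⟩, h⟩ | i) (⟨⟨i', j'⟩, h'⟩ | i') e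
    · simp only [Sum.elim_inl, shift, Subtype.mk.injEq, Prod.mk.injEq, Fin.castSucc_inj,
        Fin.succ_inj] at e
      simp [e.1, e.2]
    · simp [shift, col] at e
    · simp [shift, col, eq_comm] at e
    · simp only [Sum.elim_inr, col, Subtype.mk.injEq, Prod.mk.injEq] at e
      simp [e.1]
  · rintro ⟨⟨i, j⟩, h⟩
    cases j using Fin.cases with
    | zero => exact ⟨Sum.inr i, rfl⟩
    | succ j =>
      simp only [Fin.val_succ] at h
      exact ⟨Sum.inl ⟨(⟨i, by omega⟩, j), by simp only; omega⟩, rfl⟩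

/-- The decomposition of a staircase into its leftmost column and the rest. -/
noncomputable def splitEquiv (n : ℕ) : StairBox n ⊕ Fin (n + 1) ≃ StairBox (n + 1) :=
  Equiv.ofBijective _ bijective_elim_shift_col

lemma splitEquiv_inl (b : StairBox n) : splitEquiv n (Sum.inl b) = shift b := rfl

lemma splitEquiv_inr (i : Fin (n + 1)) : splitEquiv n (Sum.inr i) = col i := rfl

lemma forall_split {P : StairBox (n + 1) → Prop} :
    (∀ b, P b) ↔ (∀ b, P (shift b)) ∧ ∀ i, P (col i) := by
  rw [← (splitEquiv n).forall_congr_right, Sum.forall]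
  rfl

lemma exists_split {P : StairBox (n + 1) → Prop} :
    (∃ b, P b) ↔ (∃ b, P (shift b)) ∨ ∃ i, P (col i) := by
  rw [← (splitEquiv n).exists_congr_right, Sum.exists]
  rfl

@[simp] lemma onDiag_shift {b : StairBox n} : (shift b).OnDiag ↔ b.OnDiag := by
  simp only [OnDiag, shift, Fin.val_castSucc, Fin.val_succ]
  omega

@[simp] lemma onDiag_col {i : Fin (n + 1)} : (col i).OnDiag ↔ i = Fin.last n := by
  simp [OnDiag, col, Fin.ext_iff]

@[simp] lemma shift_rightOf_shift {b b' : StairBox n} :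
    (shift b').RightOf (shift b) ↔ b'.RightOf b := by
  simp [RightOf, shift]

@[simp] lemma shift_rightOf_col {b : StairBox n} {i : Fin (n + 1)} :
    (shift b).RightOf (col i) ↔ b.1.1.castSucc = i := by
  simp [RightOf, shift, col]

@[simp] lemma not_col_rightOf {b : StairBox (n + 1)} {i : Fin (n + 1)} :
    ¬ (col i).RightOf b := by
  simp [RightOf, col]

@[simp] lemma shift_below_shift {b b' : StairBox n} :
    (shift b').Below (shift b) ↔ b'.Below b := by
  simp [Below, shift]

@[simp] lemma not_shift_below_col {b : StairBox n} {i : Fin (n + 1)} :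
    ¬ (shift b).Below (col i) := by
  simp [Below, shift, col]

@[simp] lemma not_col_below_shift {b : StairBox n} {i : Fin (n + 1)} :
    ¬ (col i).Below (shift b) := by
  simp [Below, shift, col, eq_comm]

@[simp] lemma col_below_col {i j : Fin (n + 1)} : (col i).Below (col j) ↔ j < i := by
  simp [Below, col]

end StairBox

open StairBox

/-- The label of the closest labeled box below row `i` in a column with entries `c` (numbered from
top to bottom) that stands on a box labeled `s`. -/
def belowLabel : {m : ℕ} → TabLabel → (Fin m → Option TabLabel) → Fin m → TabLabel
  | 0, s, _, _ => s
  | _ + 1, s, c, i =>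
    Fin.lastCases (motive := fun _ => TabLabel) s
      (fun i => belowLabel ((c (Fin.last _)).getD s) (fun k => c k.castSucc) i) i

@[simp] lemma belowLabel_last {m : ℕ} (s : TabLabel) (c : Fin (m + 1) → Option TabLabel) :
    belowLabel s c (Fin.last m) = s := by
  simp [belowLabel]

@[simp] lemma belowLabel_castSucc {m : ℕ} (s : TabLabel) (c : Fin (m + 1) → Option TabLabel)
    (i : Fin m) : belowLabel s c i.castSucc =
      belowLabel ((c (Fin.last m)).getD s) (fun k => c k.castSucc) i := by
  simp [belowLabel]

lemma belowLabel_spec {m : ℕ} (s : TabLabel) (c : Fin m → Option TabLabel) (i : Fin m) :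
    (∃ j, i < j ∧ c j = some (belowLabel s c i) ∧ ∀ k, i < k → k < j → c k = none) ∨
      (belowLabel s c i = s ∧ ∀ j, i < j → c j = none) := by
  induction m generalizing s with
  | zero => exact i.elim0
  | succ m ih =>
    cases i using Fin.lastCases with
    | last => exact Or.inr ⟨by simp, fun j hj => absurd hj (Fin.le_last j).not_gt⟩
    | cast i =>
      rw [belowLabel_castSucc]
      rcases ih ((c (Fin.last m)).getD s) (fun k => c k.castSucc) i with
        ⟨j, h1, h2, h3⟩ | ⟨h1, h2⟩
      · refine Or.inl ⟨j.castSucc, Fin.castSucc_lt_castSucc_iff.mpr h1, h2, fun k hk hk' => ?_⟩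
        cases k using Fin.lastCases with
        | last => exact absurd hk' (Fin.le_last _).not_gt
        | cast k =>
          exact h3 k (Fin.castSucc_lt_castSucc_iff.mp hk) (Fin.castSucc_lt_castSucc_iff.mp hk')
      · rw [h1]
        rcases hc : c (Fin.last m) with _ | s'
        · refine Or.inr ⟨rfl, fun j hj => ?_⟩
          cases j using Fin.lastCases with
          | last => exact hc
          | cast j => exact h2 j (Fin.castSucc_lt_castSucc_iff.mp hj)
        · refine Or.inl ⟨Fin.last m, Fin.castSucc_lt_last i, hc, fun k hk hk' => ?_⟩
          cases k using Fin.lastCases with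
          | last => exact absurd hk' (lt_irrefl _)
          | cast k => exact h2 k (Fin.castSucc_lt_castSucc_iff.mp hk)

lemma exists_nearest_iff {n : ℕ} {s : TabLabel} {c : Fin (n + 1) → Option TabLabel}
    (hs : c (Fin.last n) = some s) (i : Fin n) (l : TabLabel) :
    (∃ j, i.castSucc < j ∧ c j = some l ∧ ∀ k, i.castSucc < k → k < j → c k = none) ↔
      belowLabel s (fun k => c k.castSucc) i = l := by
  have hex : ∃ j, i.castSucc < j ∧ c j = some (belowLabel s (fun k => c k.castSucc) i) ∧
      ∀ k, i.castSucc < k → k < j → c k = none := by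
    have := belowLabel_spec s c i.castSucc
    simp only [belowLabel_castSucc, hs, Option.getD_some] at this
    rcases this with h | ⟨-, h⟩
    · exact h
    · simpa [hs] using h _ (Fin.castSucc_lt_last i)
  constructor
  · rintro ⟨j, h1, h2, h3⟩
    obtain ⟨j', h1', h2', h3'⟩ := hex
    rcases lt_trichotomy j j' with h | rfl | h
    · simp [h3' j h1 h] at h2
    · exact Option.some_injective _ (h2'.symm.trans h2)
    · simp [h3 j' h1' h] at h2'
  · rintro rfl
    exact hex

/-- In a column, the entries above every `α` or `γ` are blank if and only if no labeled entry has
`α` or `γ` as closest label below it. -/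
lemma column_above_iff {n : ℕ} {s : TabLabel} {c : Fin (n + 1) → Option TabLabel}
    (hs : c (Fin.last n) = some s) :
    (∀ i j, i < j → (c j = some .alpha ∨ c j = some .gamma) → c i = none) ↔
      ∀ i : Fin n, c i.castSucc ≠ none → belowLabel s (fun k => c k.castSucc) i = .beta ∨
        belowLabel s (fun k => c k.castSucc) i = .delta := by
  constructor
  · intro h i hi
    obtain ⟨j, h1, h2, -⟩ := (exists_nearest_iff hs i _).mpr rfl
    by_contra hb
    refine hi (h _ j h1 ?_)
    rw [h2]
    generalize belowLabel s (fun k => c k.castSucc) i = l at hb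
    cases l <;> simp_all
  · intro h i j hij hj
    by_contra hi
    -- the lowest labeled entry above `j`
    have hne : (Finset.univ.filter fun k => k < j ∧ c k ≠ none).Nonempty :=
      ⟨i, by simp [hij, hi]⟩
    obtain ⟨k, hk, hmax⟩ := Finset.exists_max_image _ id hne
    simp only [Finset.mem_filter, Finset.mem_univ, true_and, id] at hk hmax
    obtain ⟨k', rfl⟩ : ∃ k' : Fin n, k'.castSucc = k :=
      ⟨k.castPred (hk.1.trans_le (Fin.le_last j)).ne, by simp⟩
    have key : ∀ l, c j = some l → belowLabel s (fun k => c k.castSucc) k' = l := fun l hl =>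
      (exists_nearest_iff hs k' l).mp ⟨j, hk.1, hl, fun m hm hm' => by
        by_contra hcm
        exact absurd (hmax m ⟨hm', hcm⟩) hm.not_ge⟩
    have := h k' hk.2
    rcases hj with hj | hj <;> simp [key _ hj] at this

namespace StairFilling

variable {n : ℕ}

/-- The filling of a staircase of size `n + 1` with leftmost column `c` and the rest `T`. -/
noncomputable def join (T : StairFilling n) (c : Fin (n + 1) → Option TabLabel) :
    StairFilling (n + 1) :=
  fun b => Sum.elim T c ((splitEquiv n).symm b)

@[simp] lemma join_shift (T : StairFilling n) (c : Fin (n + 1) → Option TabLabel)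
    (b : StairBox n) : join T c (shift b) = T b := by
  simp [join, ← splitEquiv_inl]

@[simp] lemma join_col (T : StairFilling n) (c : Fin (n + 1) → Option TabLabel)
    (i : Fin (n + 1)) : join T c (col i) = c i := by
  simp [join, ← splitEquiv_inr]

/-- `join` as a bijection. -/
noncomputable def joinEquiv (n : ℕ) :
    StairFilling n × (Fin (n + 1) → Option TabLabel) ≃ StairFilling (n + 1) :=
  (Equiv.sumArrowEquivProdArrow _ _ _).symm.trans
    (Equiv.arrowCongr (splitEquiv n) (Equiv.refl _))

lemma joinEquiv_apply (T : StairFilling n) (c : Fin (n + 1) → Option TabLabel) :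
    joinEquiv n (T, c) = join T c := rfl

/-- The leftmost label of row `i` (with a default value if the row is blank, which does not happen
in a tableau). -/
def rowLabel : {n : ℕ} → StairFilling n → Fin n → TabLabel
  | 0, _, _ => .alpha
  | n + 1, T, i => (T (col i)).getD
      (if h : (i : ℕ) < n then rowLabel (fun b => T (shift b)) ⟨i, h⟩ else .alpha)

lemma rowLabel_join_castSucc (T : StairFilling n) (c : Fin (n + 1) → Option TabLabel)
    (i : Fin n) : rowLabel (join T c) i.castSucc = (c i.castSucc).getD (rowLabel T i) := by
  simp [rowLabel]

lemma rowLabel_join_last (T : StairFilling n) (c : Fin (n + 1) → Option TabLabel) :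
    rowLabel (join T c) (Fin.last n) = (c (Fin.last n)).getD .alpha := by
  simp [rowLabel]

lemma exists_leftmost (T : StairFilling n) (hT : ∀ b : StairBox n, b.OnDiag → T b ≠ none)
    (i : Fin n) : ∃ b : StairBox n, b.1.1 = i ∧ T b = some (rowLabel T i) ∧
      ∀ b' : StairBox n, b.RightOf b' → T b' = none := by
  induction n with
  | zero => exact i.elim0
  | succ n ih =>
    obtain ⟨⟨T, c⟩, rfl⟩ := (joinEquiv n).surjective T
    rw [joinEquiv_apply] at *
    simp only [forall_split, onDiag_shift, join_shift, onDiag_col, join_col,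
      forall_eq] at hT
    rcases hc : c i with _ | l
    · cases i using Fin.lastCases with
      | last => exact absurd hc hT.2
      | cast i =>
        obtain ⟨b, h1, h2, h3⟩ := ih T hT.1 i
        refine ⟨shift b, by simp [shift, h1], ?_, ?_⟩
        · rw [join_shift, h2, rowLabel_join_castSucc, hc, Option.getD_none]
        · simp only [forall_split, shift_rightOf_shift, shift_rightOf_col, join_shift, join_col,
            h1, forall_eq', hc, and_true]
          exact h3
    · refine ⟨col i, rfl, ?_, fun b hb => absurd hb not_col_rightOf⟩
      cases i using Fin.lastCases with
      | last => rw [join_col, rowLabel_join_last, hc, Option.getD_some]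
      | cast i => rw [join_col, rowLabel_join_castSucc, hc, Option.getD_some]

lemma leftmost_iff {T : StairFilling n} (hT : ∀ b : StairBox n, b.OnDiag → T b ≠ none)
    (i : Fin n) (l : TabLabel) :
    (∃ b : StairBox n, b.1.1 = i ∧ T b = some l ∧ ∀ b', b'.1.1 = i → b.RightOf b' → T b' = none) ↔
      rowLabel T i = l := by
  obtain ⟨b', h1', h2', h3'⟩ := exists_leftmost T hT i
  constructor
  · rintro ⟨b, h1, h2, h3⟩
    rcases lt_trichotomy b.1.2 b'.1.2 with h | h | h
    · simp [h3' b ⟨h1'.trans h1.symm, h⟩] at h2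
    · have : b = b' := Subtype.ext (Prod.ext (h1.trans h1'.symm) h)
      subst this
      exact Option.some_injective _ (h2'.symm.trans h2)
    · simp [h3 b' h1' ⟨h1.trans h1'.symm, h⟩] at h2'
  · rintro rfl
    exact ⟨b', h1', h2', fun b _ hb => h3' b hb⟩

lemma seesRight_join_shift {T : StairFilling n} {c : Fin (n + 1) → Option TabLabel}
    {b : StairBox n} {l : TabLabel} :
    (join T c).SeesRight (shift b) l ↔ T.SeesRight b l := by
  simp [SeesRight, exists_split, forall_split, -Subtype.exists, -Subtype.forall]

lemma seesBelow_join_shift {T : StairFilling n} {c : Fin (n + 1) → Option TabLabel}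
    {b : StairBox n} {l : TabLabel} :
    (join T c).SeesBelow (shift b) l ↔ T.SeesBelow b l := by
  simp [SeesBelow, exists_split, forall_split, -Subtype.exists, -Subtype.forall]

lemma seesRight_join_col {T : StairFilling n} (hT : ∀ b : StairBox n, b.OnDiag → T b ≠ none)
    {c : Fin (n + 1) → Option TabLabel} {i : Fin n} {l : TabLabel} :
    (join T c).SeesRight (col i.castSucc) l ↔ rowLabel T i = l := by
  rw [← leftmost_iff hT]
  simp [SeesRight, exists_split, forall_split, -Subtype.exists, -Subtype.forall]

lemma seesBelow_join_col {T : StairFilling n} {c : Fin (n + 1) → Option TabLabel} {s : TabLabel}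
    (hs : c (Fin.last n) = some s) {i : Fin n} {l : TabLabel} :
    (join T c).SeesBelow (col i.castSucc) l ↔ belowLabel s (fun k => c k.castSucc) i = l := by
  rw [← exists_nearest_iff hs]
  simp [SeesBelow, exists_split, forall_split, -Subtype.exists, -Subtype.forall]

lemma boxWeight_join_shift (α β γ δ q u : ℂ) (T : StairFilling n)
    (c : Fin (n + 1) → Option TabLabel) (b : StairBox n) :
    (join T c).boxWeight α β γ δ q u (shift b) = T.boxWeight α β γ δ q u b := by
  have h1 : ∀ l, (join T c).SeesRight (shift b) l = T.SeesRight b l := fun l =>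
    propext seesRight_join_shift
  have h2 : ∀ l, (join T c).SeesBelow (shift b) l = T.SeesBelow b l := fun l =>
    propext seesBelow_join_shift
  rw [boxWeight, boxWeight, join_shift, h1, h1, h2, h2]

/-- Whether a leftmost column `c` can be added to a tableau. -/
lemma isStaircaseTableau_join_iff {T : StairFilling n} {c : Fin (n + 1) → Option TabLabel} :
    (join T c).IsStaircaseTableau ↔ T.IsStaircaseTableau ∧ c (Fin.last n) ≠ none ∧
      (∀ i : Fin n, c i.castSucc ≠ none → rowLabel T i = .alpha ∨ rowLabel T i = .gamma) ∧
      ∀ i j, i < j → (c j = some .alpha ∨ c j = some .gamma) → c i = none := by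
  constructor
  · rintro ⟨h1, h2, h3⟩
    simp only [forall_split, onDiag_shift, onDiag_col, join_shift, join_col, forall_eq,
      shift_rightOf_shift, shift_rightOf_col, not_col_rightOf, shift_below_shift,
      not_shift_below_col, not_col_below_shift, col_below_col] at h1 h2 h3
    refine ⟨⟨h1.1, fun b b' => (h2.1 b).1 b', fun b b' => (h3.1 b).1 b'⟩, h1.2, fun i hi => ?_,
      fun i j hij hj => (h3.2 i).2 j hj hij⟩
    obtain ⟨b, hb, hl, -⟩ := exists_leftmost T h1.1 i
    by_contra hr
    refine hi ((h2.2 i.castSucc).1 b ?_ (by rw [hb]))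
    rw [hl]
    generalize rowLabel T i = l at hr
    cases l <;> simp_all
  · rintro ⟨hT, h1, h2, h3⟩
    refine ⟨?_, ?_, ?_⟩ <;>
    simp only [forall_split, onDiag_shift, onDiag_col, join_shift, join_col, forall_eq,
      shift_rightOf_shift, shift_rightOf_col, not_col_rightOf, shift_below_shift,
      not_shift_below_col, not_col_below_shift, col_below_col]
    · exact ⟨hT.1, h1⟩
    · refine ⟨fun b => ⟨hT.2 b, by simp⟩, fun i => ⟨?_, by simp⟩⟩
      rintro b hb rfl
      by_contra hc
      obtain ⟨b', e1, e2, e3⟩ := exists_leftmost T hT.1 b.1.1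
      have e4 := h2 _ hc
      rcases lt_trichotomy b.1.2 b'.1.2 with h | h | h
      · simp [e3 b ⟨e1, h⟩] at hb
      · have : b = b' := Subtype.ext (Prod.ext e1.symm h)
        subst this
        rw [e2] at hb
        rcases e4 with e4 | e4 <;> simp [e4] at hb
      · simp [hT.2 b' b hb ⟨e1.symm, h⟩] at e2
    · exact ⟨fun b => ⟨hT.3 b, by simp⟩, fun i => ⟨by simp, fun j hj hij => h3 i j hij hj⟩⟩

lemma weight_join (α β γ δ q u : ℂ) (T : StairFilling n) (c : Fin (n + 1) → Option TabLabel) :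
    (join T c).weight α β γ δ q u =
      T.weight α β γ δ q u * ∏ i, (join T c).boxWeight α β γ δ q u (col i) := by
  rw [weight, ← (splitEquiv n).prod_comp, Fintype.prod_sum_type]
  simp only [splitEquiv_inl, splitEquiv_inr, boxWeight_join_shift]
  rfl

open Classical in
lemma blackCount_join (T : StairFilling n) (c : Fin (n + 1) → Option TabLabel) :
    (join T c).blackCount = T.blackCount +
      if c (Fin.last n) = some .alpha ∨ c (Fin.last n) = some .delta then 1 else 0 := by
  rw [blackCount, Finset.card_filter, ← (splitEquiv n).sum_comp, Fintype.sum_sum_type,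
    blackCount, Finset.card_filter]
  simp only [splitEquiv_inl, splitEquiv_inr, onDiag_shift, onDiag_col, join_shift, join_col]
  congr 1
  rw [Finset.sum_eq_single (Fin.last n)]
  · simp
  · intro i _ hi
    simp [hi]
  · simp

end StairFilling

/-! ### The sum over the fillings of a column -/

section Column

variable (α β γ δ q t : ℂ)

/-- The factor of a box with label `l`. -/
def labelWeight : TabLabel → ℂ
  | .alpha => α
  | .beta => β
  | .gamma => γ
  | .delta => δ

/-- The factor of a blank box that sees `l` to its right and `s` below. -/
def blankFactor : TabLabel → TabLabel → ℂ
  | .beta, _ => 1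
  | .delta, _ => q
  | _, .alpha => 1
  | _, .delta => 1
  | _, _ => q

/-- The mark of a row with leftmost label `l`: the variable `X` for a row that can still be extended,
the number `t` for a row that multiplies every further column by `q`. -/
noncomputable def labelMark : TabLabel → ℂ[X]
  | .beta => 1
  | .delta => C t
  | _ => X

/-- The contribution of a box with entry `o` that sees `l` to its right and `s` below: its factor
times the mark of its row. It vanishes if the entry is not permitted. -/
noncomputable def boxTerm (s l : TabLabel) : Option TabLabel → ℂ[X]
  | none => C (blankFactor q l s) * labelMark t l
  | some o => if (l = .alpha ∨ l = .gamma) ∧ (s = .beta ∨ s = .delta) then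
      C (labelWeight α β γ δ o) * labelMark t o else 0

/-- The sum over all fillings of the part of a column that stands on a box labeled `s`, where the
rows to the right have leftmost labels `l`. -/
noncomputable def colSum {m : ℕ} (s : TabLabel) (l : Fin m → TabLabel) : ℂ[X] :=
  ∑ c : Fin m → Option TabLabel, ∏ i, boxTerm α β γ δ q t (belowLabel s c i) (l i) (c i)

lemma colSum_zero (s : TabLabel) (l : Fin 0 → TabLabel) : colSum α β γ δ q t s l = 1 := by
  simp [colSum]

lemma colSum_succ {m : ℕ} (s : TabLabel) (l : Fin (m + 1) → TabLabel) :
    colSum α β γ δ q t s l = ∑ o : Option TabLabel, boxTerm α β γ δ q t s (l (Fin.last m)) o *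
      colSum α β γ δ q t (o.getD s) (fun i => l i.castSucc) := by
  rw [colSum, ← (Fin.snocEquiv fun _ => Option TabLabel).sum_comp, Fintype.sum_prod_type]
  refine Finset.sum_congr rfl fun o _ => ?_
  rw [colSum, Finset.mul_sum]
  refine Finset.sum_congr rfl fun c _ => ?_
  rw [Fin.prod_univ_castSucc, mul_comm]
  simp [Fin.snocEquiv]

lemma sum_option_tabLabel {M : Type*} [AddCommMonoid M] (f : Option TabLabel → M) :
    ∑ o, f o = f none + (f (some .alpha) + f (some .beta) + f (some .gamma) + f (some .delta)) := by
  have : (Finset.univ : Finset TabLabel) = {.alpha, .beta, .gamma, .delta} := rfl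
  rw [Fintype.sum_option, this]
  simp [add_assoc]

/-- The sum over the fillings of a whole column whose diagonal box is labeled `α` or `δ`. -/
noncomputable def colSumBlack {m : ℕ} (l : Fin m → TabLabel) : ℂ[X] :=
  C α * X * colSum α β γ δ q t .alpha l + C (δ * t) * colSum α β γ δ q t .delta l

/-- The sum over the fillings of a whole column whose diagonal box is labeled `β` or `γ`. -/
noncomputable def colSumWhite {m : ℕ} (l : Fin m → TabLabel) : ℂ[X] :=
  C γ * X * colSum α β γ δ q t .gamma l + C β * colSum α β γ δ q t .beta l

variable {α β γ δ q t}

lemma colSum_succ_of_beta {m : ℕ} {l : Fin (m + 1) → TabLabel} (hl : l (Fin.last m) = .beta)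
    (s : TabLabel) :
    colSum α β γ δ q t s l = colSum α β γ δ q t s (fun i => l i.castSucc) := by
  rw [colSum_succ, sum_option_tabLabel, hl]
  simp [boxTerm, blankFactor, labelMark]

lemma colSum_succ_of_delta {m : ℕ} {l : Fin (m + 1) → TabLabel} (hl : l (Fin.last m) = .delta)
    (s : TabLabel) :
    colSum α β γ δ q t s l = C (q * t) * colSum α β γ δ q t s (fun i => l i.castSucc) := by
  rw [colSum_succ, sum_option_tabLabel, hl]
  simp [boxTerm, blankFactor, labelMark]

lemma colSumBlack_succ_of_live {m : ℕ} {l : Fin (m + 1) → TabLabel}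
    (hl : l (Fin.last m) = .alpha ∨ l (Fin.last m) = .gamma) :
    colSumBlack α β γ δ q t l = X * colSumBlack α β γ δ q t (fun i => l i.castSucc) +
      C (δ * t) * (colSumBlack α β γ δ q t (fun i => l i.castSucc) +
        colSumWhite α β γ δ q t (fun i => l i.castSucc)) := by
  simp only [colSumBlack, colSumWhite]
  rw [colSum_succ, colSum_succ, sum_option_tabLabel, sum_option_tabLabel]
  rcases hl with hl | hl <;> simp [hl, boxTerm, blankFactor, labelMark, labelWeight] <;> ring

lemma colSumWhite_succ_of_live {m : ℕ} {l : Fin (m + 1) → TabLabel}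
    (hl : l (Fin.last m) = .alpha ∨ l (Fin.last m) = .gamma) :
    colSumWhite α β γ δ q t l = C q * (X * colSumWhite α β γ δ q t (fun i => l i.castSucc)) +
      C β * (colSumBlack α β γ δ q t (fun i => l i.castSucc) +
        colSumWhite α β γ δ q t (fun i => l i.castSucc)) := by
  simp only [colSumBlack, colSumWhite]
  rw [colSum_succ, colSum_succ, sum_option_tabLabel, sum_option_tabLabel]
  rcases hl with hl | hl <;> simp [hl, boxTerm, blankFactor, labelMark, labelWeight] <;> ring

end Column

/-! ### Tableaux and the matrix ansatz -/

/-- The relations of the matrix ansatz: a vector `W` and operators `D`, `E` (acting in the order in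
which a word in the letters `D`, `E` is read, so that `E (D u)` stands for `W ⋯ D E`), and a
functional `V`. -/
structure MatrixAnsatz {M : Type*} [AddCommGroup M] [Module ℂ M] (α β γ δ q : ℂ)
    (D E : Module.End ℂ M) (W : M) (V : M →ₗ[ℂ] ℂ) : Prop where
  bulk : ∀ u, E (D u) = q • D (E u) + D u + E u
  left : α • E W = γ • D W + W
  right : ∀ u, β * V (D u) - δ * V (E u) = V u
  norm : V W = 1

section Ansatz

variable {M : Type*} [AddCommGroup M] [Module ℂ M]

/-- The vector `W (β D - δ t E)^i`, extended linearly from `X ^ i`: it represents `i` rows of a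
tableau that can still be extended. -/
noncomputable def markVec (β δ : ℂ) (D E : Module.End ℂ M) (W : M) (t : ℂ) : ℂ[X] →ₗ[ℂ] M :=
  LinearMap.applyₗ W ∘ₗ (aeval (R := ℂ) (β • D - (δ * t) • E)).toLinearMap

lemma markVec_one (β δ : ℂ) (D E : Module.End ℂ M) (W : M) (t : ℂ) :
    markVec β δ D E W t 1 = W := by
  simp [markVec]

lemma markVec_X_mul (β δ : ℂ) (D E : Module.End ℂ M) (W : M) (t : ℂ) (p : ℂ[X]) :
    markVec β δ D E W t (X * p) = β • D (markVec β δ D E W t p) -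
      (δ * t) • E (markVec β δ D E W t p) := by
  simp [markVec]

lemma markVec_C_mul (β δ : ℂ) (D E : Module.End ℂ M) (W : M) (t r : ℂ) (p : ℂ[X]) :
    markVec β δ D E W t (C r * p) = r • markVec β δ D E W t p := by
  rw [← smul_eq_C_mul, map_smul]

variable {α β γ δ q : ℂ} {D E : Module.End ℂ M} {W : M} {V : M →ₗ[ℂ] ℂ}

/-- Adding a column to a tableau amounts to appending a letter to the word, because
`(β D - δ q t E) D = D (β D - δ t E) + δ t (D + E)` and
`(β D - δ q t E) E = q E (β D - δ t E) + β (D + E)` are the recursions for the column sums. -/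
lemma MatrixAnsatz.markVec_colSum (h : MatrixAnsatz α β γ δ q D E W V) (t : ℂ) {m : ℕ}
    (l : Fin m → TabLabel) :
    markVec β δ D E W t (colSumBlack α β γ δ q t l) =
        (α * β - γ * δ * t) • D (markVec β δ D E W (q * t) (∏ i, labelMark (q * t) (l i))) ∧
      markVec β δ D E W t (colSumWhite α β γ δ q t l) =
        (α * β - γ * δ * t) • E (markVec β δ D E W (q * t) (∏ i, labelMark (q * t) (l i))) := by
  induction m with
  | zero =>
    have hX := markVec_X_mul β δ D E W t 1
    rw [mul_one, markVec_one] at hX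
    simp only [colSumBlack, colSumWhite, colSum_zero, mul_one, Finset.univ_eq_empty,
      Finset.prod_empty, markVec_one, map_add, markVec_C_mul, hX]
    have hC : ∀ r : ℂ, markVec β δ D E W t (C r) = r • W := fun r => by
      simpa [markVec_one] using markVec_C_mul β δ D E W t r 1
    rw [hC, hC]
    constructor
    · have := congrArg (fun v => (δ * t) • v) h.left
      simp only [smul_add, smul_smul] at this
      rw [smul_sub, smul_smul, smul_smul, mul_comm α (δ * t), this]
      module
    · have := congrArg (fun v => β • v) h.left
      simp only [smul_add, smul_smul] at this
      rw [smul_sub, smul_smul, smul_smul, mul_comm γ β, sub_smul, mul_comm α β, this]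
      module
  | succ m ih =>
    obtain ⟨ihD, ihE⟩ := ih fun i => l i.castSucc
    rw [Fin.prod_univ_castSucc]
    set u := markVec β δ D E W (q * t) (∏ i : Fin m, labelMark (q * t) (l i.castSucc)) with hu
    have dead : ∀ r : ℂ, labelMark (q * t) (l (Fin.last m)) = C r →
        (∀ s, colSum α β γ δ q t s l = C r * colSum α β γ δ q t s (fun i => l i.castSucc)) →
        markVec β δ D E W t (colSumBlack α β γ δ q t l) = (α * β - γ * δ * t) •
          D (markVec β δ D E W (q * t) ((∏ i : Fin m, labelMark (q * t) (l i.castSucc)) *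
            labelMark (q * t) (l (Fin.last m)))) ∧
        markVec β δ D E W t (colSumWhite α β γ δ q t l) = (α * β - γ * δ * t) •
          E (markVec β δ D E W (q * t) ((∏ i : Fin m, labelMark (q * t) (l i.castSucc)) *
            labelMark (q * t) (l (Fin.last m)))) := by
      intro r h1 h2
      have e1 : colSumBlack α β γ δ q t l =
          C r * colSumBlack α β γ δ q t (fun i => l i.castSucc) := by
        simp only [colSumBlack, h2]; ring
      have e2 : colSumWhite α β γ δ q t l =
          C r * colSumWhite α β γ δ q t (fun i => l i.castSucc) := by
        simp only [colSumWhite, h2]; ring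
      rw [h1, mul_comm _ (C r), markVec_C_mul, ← hu, e1, e2, markVec_C_mul, markVec_C_mul, ihD,
        ihE, map_smul, map_smul]
      constructor <;> module
    have live : (l (Fin.last m) = .alpha ∨ l (Fin.last m) = .gamma) →
        markVec β δ D E W t (colSumBlack α β γ δ q t l) = (α * β - γ * δ * t) •
          D (markVec β δ D E W (q * t) ((∏ i : Fin m, labelMark (q * t) (l i.castSucc)) *
            labelMark (q * t) (l (Fin.last m)))) ∧
        markVec β δ D E W t (colSumWhite α β γ δ q t l) = (α * β - γ * δ * t) •
          E (markVec β δ D E W (q * t) ((∏ i : Fin m, labelMark (q * t) (l i.castSucc)) *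
            labelMark (q * t) (l (Fin.last m)))) := by
      intro hl
      have hm : labelMark (q * t) (l (Fin.last m)) = X := by
        rcases hl with hl | hl <;> rw [hl] <;> rfl
      rw [hm, mul_comm _ X, markVec_X_mul, ← hu, colSumBlack_succ_of_live hl,
        colSumWhite_succ_of_live hl]
      simp only [map_add, map_sub, markVec_C_mul, markVec_X_mul, ihD, ihE, map_smul, h.bulk]
      constructor <;> module
    rcases hl : l (Fin.last m) with _ | _ | _ | _
    · rw [← hl]; exact live (Or.inl hl)
    · rw [← hl]
      exact dead 1 (by rw [hl]; simp [labelMark]) fun s => by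
        rw [colSum_succ_of_beta hl, C_1, one_mul]
    · rw [← hl]; exact live (Or.inr hl)
    · rw [← hl]
      exact dead (q * t) (by rw [hl]; rfl) fun s => colSum_succ_of_delta hl s

open Classical in
/-- The contribution of a filling of size `n + 1` in terms of its leftmost column. -/
lemma join_term {n : ℕ} (y t : ℂ) {T : StairFilling n} (hT : T.IsStaircaseTableau)
    (c : Fin (n + 1) → Option TabLabel) :
    (if (T.join c).IsStaircaseTableau then
      C ((T.join c).weight α β γ δ q 1 * y ^ (T.join c).blackCount) *
        ∏ i, labelMark t ((T.join c).rowLabel i) else 0) =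
      C (T.weight α β γ δ q 1 * y ^ T.blackCount) *
        (match c (Fin.last n) with
          | none => 0
          | some s => C ((if s = .alpha ∨ s = .delta then y else 1) * labelWeight α β γ δ s) *
              labelMark t s * ∏ i : Fin n, boxTerm α β γ δ q t
                (belowLabel s (fun k => c k.castSucc) i) (T.rowLabel i) (c i.castSucc)) := by
  rcases hs : c (Fin.last n) with _ | s
  · rw [if_neg fun h => (StairFilling.isStaircaseTableau_join_iff.mp h).2.1 hs]
    simp
  · simp only
    by_cases hJ : (T.join c).IsStaircaseTableau
    · rw [if_pos hJ]
      obtain ⟨-, -, h1, h2⟩ := StairFilling.isStaircaseTableau_join_iff.mp hJ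
      rw [column_above_iff hs] at h2
      rw [StairFilling.weight_join, StairFilling.blackCount_join, Fin.prod_univ_castSucc,
        Fin.prod_univ_castSucc, StairFilling.rowLabel_join_last, hs, Option.getD_some]
      have e1 : (T.join c).boxWeight α β γ δ q 1 (col (Fin.last n)) = labelWeight α β γ δ s := by
        rw [StairFilling.boxWeight, StairFilling.join_col, hs]
        cases s <;> rfl
      have e2 : ∀ i : Fin n, boxTerm α β γ δ q t (belowLabel s (fun k => c k.castSucc) i)
          (T.rowLabel i) (c i.castSucc) =
          C ((T.join c).boxWeight α β γ δ q 1 (col i.castSucc)) *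
            labelMark t ((T.join c).rowLabel i.castSucc) := by
        intro i
        rw [StairFilling.boxWeight, StairFilling.join_col, StairFilling.rowLabel_join_castSucc]
        rcases hc : c i.castSucc with _ | o
        · simp only [StairFilling.seesRight_join_col hT.1, StairFilling.seesBelow_join_col hs]
          rw [boxTerm, Option.getD_none]
          congr 2
          generalize belowLabel s (fun k => c k.castSucc) i = b
          cases T.rowLabel i <;> cases b <;> simp [blankFactor]
        · have hc' : c i.castSucc ≠ none := by simp [hc]
          rw [boxTerm, if_pos ⟨h1 i hc', h2 i hc'⟩, Option.getD_some]
          cases o <;> rfl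
      rw [e1, Finset.prod_congr rfl fun i _ => e2 i, Finset.prod_mul_distrib]
      have e3 : y ^ (T.blackCount + if some s = some TabLabel.alpha ∨ some s = some TabLabel.delta
          then 1 else 0) = y ^ T.blackCount * if s = .alpha ∨ s = .delta then y else 1 := by
        cases s <;> simp [pow_succ]
      rw [e3]
      simp only [map_mul, map_prod]
      ring
    · rw [if_neg hJ]
      rw [StairFilling.isStaircaseTableau_join_iff, column_above_iff hs] at hJ
      -- an entry that is not permitted contributes the factor `0`
      have : ∃ i : Fin n, boxTerm α β γ δ q t (belowLabel s (fun k => c k.castSucc) i)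
          (T.rowLabel i) (c i.castSucc) = 0 := by
        by_contra! hne
        have key : ∀ i : Fin n, c i.castSucc ≠ none →
            (T.rowLabel i = .alpha ∨ T.rowLabel i = .gamma) ∧
            (belowLabel s (fun k => c k.castSucc) i = .beta ∨
              belowLabel s (fun k => c k.castSucc) i = .delta) := by
          intro i hi
          obtain ⟨o, ho⟩ := Option.ne_none_iff_exists'.mp hi
          by_contra hcon
          refine hne i ?_
          rw [ho, boxTerm, if_neg hcon]
        exact hJ ⟨hT, by simp [hs], fun i hi => (key i hi).1, fun i hi => (key i hi).2⟩
      obtain ⟨i, hi⟩ := this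
      rw [Finset.prod_eq_zero (Finset.mem_univ i) hi, mul_zero, mul_zero]

open Classical in
/-- The sum over the tableaux of size `n`, each with the marks of its rows. -/
noncomputable def markedSum (α β γ δ q y t : ℂ) (n : ℕ) : ℂ[X] :=
  ∑ T : StairFilling n, if T.IsStaircaseTableau then
    C (T.weight α β γ δ q 1 * y ^ T.blackCount) * ∏ i, labelMark t (T.rowLabel i) else 0

open Classical in
lemma markedSum_succ (α β γ δ q y t : ℂ) (n : ℕ) :
    markedSum α β γ δ q y t (n + 1) = ∑ T : StairFilling n, if T.IsStaircaseTableau then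
      C (T.weight α β γ δ q 1 * y ^ T.blackCount) * (C y * colSumBlack α β γ δ q t T.rowLabel +
        colSumWhite α β γ δ q t T.rowLabel) else 0 := by
  rw [markedSum, ← (StairFilling.joinEquiv n).sum_comp, Fintype.sum_prod_type]
  refine Finset.sum_congr rfl fun T _ => ?_
  by_cases hT : T.IsStaircaseTableau
  · rw [if_pos hT]
    refine (Finset.sum_congr rfl fun c _ => join_term y t hT c).trans ?_
    rw [← Finset.mul_sum]
    congr 1
    rw [← (Fin.snocEquiv fun _ => Option TabLabel).sum_comp, Fintype.sum_prod_type,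
      sum_option_tabLabel]
    simp only [Fin.snocEquiv, Equiv.coe_fn_mk, Fin.snoc_last, Fin.snoc_castSucc,
      Finset.sum_const_zero, ← Finset.mul_sum, zero_add]
    simp [colSumBlack, colSumWhite, colSum, labelMark, labelWeight]
    ring
  · rw [if_neg hT]
    refine Finset.sum_eq_zero fun c _ => if_neg fun h => hT ?_
    exact (StairFilling.isStaircaseTableau_join_iff.mp h).1

lemma MatrixAnsatz.markVec_markedSum (h : MatrixAnsatz α β γ δ q D E W V) (y t : ℂ) (n : ℕ) :
    markVec β δ D E W t (markedSum α β γ δ q y t n) =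
      (∏ j ∈ Finset.range n, (α * β - γ * δ * (t * q ^ j))) • ((y • D + E) ^ n) W := by
  induction n generalizing t with
  | zero =>
    have hT : ∀ T : StairFilling 0, T.IsStaircaseTableau := fun T =>
      ⟨fun c => c.1.1.elim0, fun c => c.1.1.elim0, fun c => c.1.1.elim0⟩
    have : IsEmpty (StairBox 0) := ⟨fun b => b.1.1.elim0⟩
    simp [markedSum, hT, StairFilling.weight, StairFilling.blackCount, markVec_one]
  | succ n ih =>
    have key : markVec β δ D E W t (markedSum α β γ δ q y t (n + 1)) =
        (α * β - γ * δ * t) • (y • D + E) (markVec β δ D E W (q * t)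
          (markedSum α β γ δ q y (q * t) n)) := by
      rw [markedSum_succ, markedSum]
      simp only [map_sum, Finset.smul_sum]
      refine Finset.sum_congr rfl fun T _ => ?_
      split_ifs
      · obtain ⟨e1, e2⟩ := h.markVec_colSum t T.rowLabel
        rw [markVec_C_mul, markVec_C_mul, map_add, markVec_C_mul, e1, e2, map_smul,
          LinearMap.add_apply, LinearMap.smul_apply]
        module
      · simp
    rw [key, ih, Finset.prod_range_succ', map_smul, smul_smul, pow_succ', Module.End.mul_apply]
    congr 1
    rw [mul_comm, pow_zero, mul_one]
    congr 1
    exact Finset.prod_congr rfl fun j _ => by ring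

/-- The generating polynomial of staircase tableaux as a matrix product. -/
lemma MatrixAnsatz.fugacityZ_eq (h : MatrixAnsatz α β γ δ q D E W V) (y : ℂ) (n : ℕ) :
    fugacityZ n y α β γ δ q =
      (∏ j ∈ Finset.range n, (α * β - γ * δ * q ^ j)) * V (((y • D + E) ^ n) W) := by
  -- for `t = 1` the functional does not see the marks
  have hX : ∀ p, V (markVec β δ D E W 1 (X * p)) = V (markVec β δ D E W 1 p) := fun p => by
    rw [markVec_X_mul, map_sub, map_smul, map_smul, smul_eq_mul, smul_eq_mul, mul_one, h.right]
  have hl : ∀ p l, V (markVec β δ D E W 1 (labelMark 1 l * p)) = V (markVec β δ D E W 1 p) := by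
    intro p l
    cases l <;> simp [labelMark, hX]
  have hmark : ∀ (s : Finset (Fin n)) (l : Fin n → TabLabel),
      V (markVec β δ D E W 1 (∏ i ∈ s, labelMark 1 (l i))) = 1 := by
    intro s l
    induction s using Finset.induction_on with
    | empty => rw [Finset.prod_empty, markVec_one, h.norm]
    | insert i s hi ih =>
      rw [Finset.prod_insert hi, hl, ih]
  have := congrArg V (h.markVec_markedSum y 1 n)
  simp only [one_mul, map_smul, smul_eq_mul] at this
  rw [← this, markedSum, fugacityZ, Finset.sum_filter, map_sum, map_sum]
  refine Finset.sum_congr rfl fun T _ => ?_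
  split_ifs
  · rw [markVec_C_mul, map_smul, hmark, smul_eq_mul, mul_one]
  · simp

end Ansatz

open Filter Topology Real

/-! ### The infinite `q`-shifted factorial -/

lemma summable_norm_qPochInf (a : ℂ) {q : ℂ} (hq : ‖q‖ < 1) :
    Summable fun k : ℕ => ‖-(a * q ^ k)‖ := by
  simp only [norm_neg, norm_mul, norm_pow]
  exact (summable_geometric_of_lt_one (norm_nonneg q) hq).mul_left _

lemma multipliable_qPochInf (a : ℂ) {q : ℂ} (hq : ‖q‖ < 1) :
    Multipliable fun k : ℕ => 1 - a * q ^ k := by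
  simpa only [← sub_eq_add_neg] using multipliable_one_add_of_summable (summable_norm_qPochInf a hq)

lemma qPochInf_eq_mul (a : ℂ) {q : ℂ} (hq : ‖q‖ < 1) :
    qPochInf a q = (1 - a) * qPochInf (a * q) q := by
  have h : ∀ k : ℕ, 1 - a * q ^ (k + 1) = 1 - a * q * q ^ k := fun k => by rw [pow_succ']; ring
  rw [qPochInf, tprod_eq_zero_mul' (by simpa only [h] using multipliable_qPochInf (a * q) hq)]
  simp only [h, pow_zero, mul_one]
  rfl

lemma qPochInf_ne_zero {a q : ℂ} (ha : ‖a‖ < 1) (hq : ‖q‖ < 1) : qPochInf a q ≠ 0 := by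
  rw [qPochInf]
  simp only [sub_eq_add_neg]
  refine tprod_one_add_ne_zero_of_summable (fun k e => ?_) (summable_norm_qPochInf a hq)
  have h1 : a * q ^ k = 1 := by linear_combination -e
  have h2 : ‖a * q ^ k‖ < 1 := by
    rw [norm_mul, norm_pow]
    exact (mul_le_of_le_one_right (norm_nonneg a)
      (pow_le_one₀ (norm_nonneg q) hq.le)).trans_lt ha
  rw [h1, norm_one] at h2
  exact lt_irrefl _ h2

lemma qPochInf_mul_neg (a : ℂ) {q : ℂ} (hq : ‖q‖ < 1) :
    qPochInf a q * qPochInf (-a) q = qPochInf (a ^ 2) (q ^ 2) := by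
  rw [qPochInf, qPochInf, ← (multipliable_qPochInf a hq).tprod_mul (multipliable_qPochInf (-a) hq),
    qPochInf]
  exact tprod_congr fun k => by ring

lemma qPochInf_even_mul_odd (a : ℂ) {q : ℂ} (hq : ‖q‖ < 1) :
    qPochInf a (q ^ 2) * qPochInf (a * q) (q ^ 2) = qPochInf a q := by
  have hq2 : ‖q ^ 2‖ < 1 := by
    rw [norm_pow]; exact pow_lt_one₀ (norm_nonneg q) hq two_ne_zero
  have h1 : ∀ k : ℕ, 1 - a * q ^ (2 * k) = 1 - a * (q ^ 2) ^ k := fun k => by rw [pow_mul]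
  have h2 : ∀ k : ℕ, 1 - a * q ^ (2 * k + 1) = 1 - a * q * (q ^ 2) ^ k := fun k => by
    rw [pow_succ', pow_mul]; ring
  have := tprod_even_mul_odd (f := fun k : ℕ => 1 - a * q ^ k)
    (by simpa only [h1] using multipliable_qPochInf a hq2)
    (by simpa only [h2] using multipliable_qPochInf (a * q) hq2)
  simpa only [h1, h2, qPochInf] using this

lemma hasProdLocallyUniformlyOn_qPochInf {X : Type*} [TopologicalSpace X] [LocallyCompactSpace X]
    {U : Set X} (hU : IsOpen U) {f g : X → ℂ} (hf : ContinuousOn f U) (hg : ContinuousOn g U)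
    (h : ∀ x ∈ U, ‖g x‖ < 1) :
    HasProdLocallyUniformlyOn (fun (k : ℕ) x => 1 - f x * g x ^ k)
      (fun x => qPochInf (f x) (g x)) U := by
  refine hasProdLocallyUniformlyOn_of_forall_compact hU fun K hKU hK => ?_
  obtain ⟨R, hR⟩ := hK.exists_bound_of_continuousOn (hf.mono hKU)
  obtain ⟨r, hr0, hr1, hr⟩ : ∃ r : ℝ, 0 ≤ r ∧ r < 1 ∧ ∀ x ∈ K, ‖g x‖ ≤ r := by
    rcases K.eq_empty_or_nonempty with rfl | hne
    · exact ⟨0, le_rfl, one_pos, by simp⟩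
    · obtain ⟨x, hx, hmax⟩ := hK.exists_isMaxOn hne (hg.mono hKU).norm
      exact ⟨‖g x‖, norm_nonneg _, h x (hKU hx), fun y hy => hmax hy⟩
  have := Summable.hasProdUniformlyOn_nat_one_add (f := fun (k : ℕ) x => -(f x * g x ^ k)) hK
    ((summable_geometric_of_lt_one hr0 hr1).mul_left R)
    (Eventually.of_forall fun k x hx => by
      rw [norm_neg, norm_mul, norm_pow]
      exact mul_le_mul (hR x hx) (pow_le_pow_left₀ (norm_nonneg _) (hr x hx) k) (by positivity)
        ((norm_nonneg _).trans (hR x hx)))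
    (fun k => ((hf.mul (hg.pow k)).neg).mono hKU)
  simpa only [← sub_eq_add_neg, qPochInf] using this

lemma differentiable_qPochInf {q : ℂ} (hq : ‖q‖ < 1) : Differentiable ℂ fun a => qPochInf a q := by
  rw [← differentiableOn_univ]
  refine TendstoLocallyUniformlyOn.differentiableOn
    (hasProdLocallyUniformlyOn_qPochInf isOpen_univ continuousOn_id (continuousOn_const (c := q))
      fun _ _ => hq) (Eventually.of_forall fun s => ?_) isOpen_univ
  exact DifferentiableOn.fun_finsetProd fun k _ => by fun_prop

lemma continuousOn_qPochInf : ContinuousOn (fun p : ℂ × ℂ => qPochInf p.1 p.2) {p | ‖p.2‖ < 1} := by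
  refine TendstoLocallyUniformlyOn.continuousOn
    (hasProdLocallyUniformlyOn_qPochInf (isOpen_lt (by fun_prop) continuous_const)
      continuousOn_fst continuousOn_snd fun _ hp => hp)
    (Eventually.of_forall fun s => ?_).frequently
  exact continuousOn_finsetProd _ fun k _ => by fun_prop

lemma Continuous.qPochInf {X : Type*} [TopologicalSpace X] {f g : X → ℂ} (hf : Continuous f)
    (hg : Continuous g) (h : ∀ x, ‖g x‖ < 1) : Continuous fun x => qPochInf (f x) (g x) :=
  continuousOn_qPochInf.comp_continuous (hf.prodMk hg) h

/-! ### The Askey-Wilson integral -/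

lemma awIntegral_eq (a b c d q : ℂ) (f : ℂ → ℂ) : awIntegral a b c d q f =
    (1 / 2) * circleAverage (fun z => awWeight a b c d q z * f ((z + z⁻¹) / 2)) 0 1 := by
  rw [circleAverage_eq_circleIntegral one_ne_zero, awIntegral, smul_eq_mul, ← mul_assoc,
    ← circleIntegral.integral_const_mul]
  congr 1
  funext z
  simp only [mul_inv, sub_zero, smul_eq_mul]
  ring

/-- The parameters for which the Askey-Wilson weight is integrated over the unit circle. -/
structure InDisc (a b c d q : ℂ) : Prop where
  q : ‖q‖ < 1
  a : ‖a‖ < 1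
  b : ‖b‖ < 1
  c : ‖c‖ < 1
  d : ‖d‖ < 1

lemma norm_mul_lt_one {a b : ℂ} (ha : ‖a‖ < 1) (hb : ‖b‖ < 1) : ‖a * b‖ < 1 := by
  rw [norm_mul]
  exact mul_lt_one_of_nonneg_of_lt_one_left (norm_nonneg a) ha hb.le

lemma norm_mul_lt_one_of_sphere {a z : ℂ} (ha : ‖a‖ < 1) (hz : ‖z‖ = 1) : ‖a * z‖ < 1 := by
  rwa [norm_mul, hz, mul_one]

lemma norm_mul_inv_lt_one_of_sphere {a z : ℂ} (ha : ‖a‖ < 1) (hz : ‖z‖ = 1) : ‖a * z⁻¹‖ < 1 := by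
  rwa [norm_mul, norm_inv, hz, inv_one, mul_one]

lemma InDisc.awH0_ne_zero {a b c d q : ℂ} (h : InDisc a b c d q) : awH0 a b c d q ≠ 0 := by
  refine div_ne_zero (qPochInf_ne_zero (norm_mul_lt_one (norm_mul_lt_one
    (norm_mul_lt_one h.a h.b) h.c) h.d) h.q) ?_
  simp only [mul_ne_zero_iff]
  exact ⟨⟨⟨⟨⟨⟨qPochInf_ne_zero h.q h.q, qPochInf_ne_zero (norm_mul_lt_one h.a h.b) h.q⟩,
    qPochInf_ne_zero (norm_mul_lt_one h.a h.c) h.q⟩,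
    qPochInf_ne_zero (norm_mul_lt_one h.a h.d) h.q⟩,
    qPochInf_ne_zero (norm_mul_lt_one h.b h.c) h.q⟩,
    qPochInf_ne_zero (norm_mul_lt_one h.b h.d) h.q⟩,
    qPochInf_ne_zero (norm_mul_lt_one h.c h.d) h.q⟩

/-- The integrals depend continuously on the parameters. -/
lemma continuous_awIntegral {X : Type*} [TopologicalSpace X]
    {a b c d q : X → ℂ} (ha : Continuous a) (hb : Continuous b) (hc : Continuous c)
    (hd : Continuous d) (hq : Continuous q) (h : ∀ x, InDisc (a x) (b x) (c x) (d x) (q x))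
    {f : ℂ → ℂ} (hf : Continuous f) :
    Continuous fun x => awIntegral (a x) (b x) (c x) (d x) (q x) f := by
  simp only [awIntegral_eq]
  refine Continuous.const_mul ?_ _
  refine (intervalIntegral.continuous_parametric_intervalIntegral_of_continuous' ?_ _ _).const_smul _
  have hz : Continuous fun p : X × ℝ => circleMap 0 1 p.2 := (continuous_circleMap 0 1).comp
    continuous_snd
  have hn : ∀ θ : ℝ, ‖circleMap 0 1 θ‖ = 1 := fun θ => by simp
  have hzi : Continuous fun p : X × ℝ => (circleMap 0 1 p.2)⁻¹ :=
    hz.inv₀ fun p => by simp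
  have hx : ∀ {g : X → ℂ}, Continuous g → Continuous fun p : X × ℝ => g p.1 :=
    fun hg => hg.comp continuous_fst
  have hq1 : ∀ p : X × ℝ, ‖q p.1‖ < 1 := fun p => (h p.1).q
  have P : ∀ {g : X × ℝ → ℂ}, Continuous g → Continuous fun p : X × ℝ => qPochInf (g p) (q p.1) :=
    fun hg => hg.qPochInf (hx hq) hq1
  refine Continuous.mul ?_ (hf.comp ((hz.add hzi).div_const 2))
  refine Continuous.div ?_ ?_ ?_
  · exact (P (hz.pow 2)).mul (P (hzi.pow 2))
  · refine Continuous.mul ?_ ?_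
    · refine Continuous.div (P (((hx ha).mul (hx hb)).mul (hx hc) |>.mul (hx hd))) ?_ ?_
      · exact ((((((P (hx hq)).mul (P ((hx ha).mul (hx hb)))).mul (P ((hx ha).mul (hx hc)))).mul
          (P ((hx ha).mul (hx hd)))).mul (P ((hx hb).mul (hx hc)))).mul
          (P ((hx hb).mul (hx hd)))).mul (P ((hx hc).mul (hx hd)))
      · intro p
        exact (div_ne_zero_iff.mp (h p.1).awH0_ne_zero).2
    · exact (((((((P ((hx ha).mul hz)).mul (P ((hx ha).mul hzi))).mul (P ((hx hb).mul hz))).mul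
        (P ((hx hb).mul hzi))).mul (P ((hx hc).mul hz))).mul (P ((hx hc).mul hzi))).mul
        (P ((hx hd).mul hz))).mul (P ((hx hd).mul hzi))
  · intro p
    have hp := h p.1
    simp only [mul_ne_zero_iff]
    exact ⟨hp.awH0_ne_zero, ⟨⟨⟨⟨⟨⟨
      qPochInf_ne_zero (norm_mul_lt_one_of_sphere hp.a (hn p.2)) hp.q,
      qPochInf_ne_zero (norm_mul_inv_lt_one_of_sphere hp.a (hn p.2)) hp.q⟩,
      qPochInf_ne_zero (norm_mul_lt_one_of_sphere hp.b (hn p.2)) hp.q⟩,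
      qPochInf_ne_zero (norm_mul_inv_lt_one_of_sphere hp.b (hn p.2)) hp.q⟩,
      qPochInf_ne_zero (norm_mul_lt_one_of_sphere hp.c (hn p.2)) hp.q⟩,
      qPochInf_ne_zero (norm_mul_inv_lt_one_of_sphere hp.c (hn p.2)) hp.q⟩,
      qPochInf_ne_zero (norm_mul_lt_one_of_sphere hp.d (hn p.2)) hp.q⟩,
      qPochInf_ne_zero (norm_mul_inv_lt_one_of_sphere hp.d (hn p.2)) hp.q⟩

lemma InDisc.continuousOn_awWeight {a b c d q : ℂ} (h : InDisc a b c d q) :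
    ContinuousOn (awWeight a b c d q) (Metric.sphere 0 1) := by
  have hn : ∀ z ∈ Metric.sphere (0 : ℂ) 1, ‖z‖ = 1 := fun z hz => by simpa using hz
  have hinv : ContinuousOn (fun z : ℂ => z⁻¹) (Metric.sphere 0 1) :=
    continuousOn_id.inv₀ fun z hz => Metric.ne_of_mem_sphere hz one_ne_zero
  have P : ∀ {g : ℂ → ℂ}, ContinuousOn g (Metric.sphere 0 1) →
      ContinuousOn (fun z => qPochInf (g z) q) (Metric.sphere 0 1) := fun hg =>
    (differentiable_qPochInf h.q).continuous.comp_continuousOn hg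
  have Pz : ∀ r : ℂ, ContinuousOn (fun z => qPochInf (r * z) q) (Metric.sphere 0 1) := fun r =>
    P (continuousOn_const.mul continuousOn_id)
  have Pi : ∀ r : ℂ, ContinuousOn (fun z => qPochInf (r * z⁻¹) q) (Metric.sphere 0 1) := fun r =>
    P (continuousOn_const.mul hinv)
  refine ContinuousOn.div ((P (continuousOn_id.pow 2)).mul (P (hinv.pow 2)))
    (continuousOn_const.mul ((((((((Pz a).mul (Pi a)).mul (Pz b)).mul (Pi b)).mul (Pz c)).mul
      (Pi c)).mul (Pz d)).mul (Pi d))) fun z hz => ?_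
  simp only [mul_ne_zero_iff]
  exact ⟨h.awH0_ne_zero, ⟨⟨⟨⟨⟨⟨
    qPochInf_ne_zero (norm_mul_lt_one_of_sphere h.a (hn z hz)) h.q,
    qPochInf_ne_zero (norm_mul_inv_lt_one_of_sphere h.a (hn z hz)) h.q⟩,
    qPochInf_ne_zero (norm_mul_lt_one_of_sphere h.b (hn z hz)) h.q⟩,
    qPochInf_ne_zero (norm_mul_inv_lt_one_of_sphere h.b (hn z hz)) h.q⟩,
    qPochInf_ne_zero (norm_mul_lt_one_of_sphere h.c (hn z hz)) h.q⟩,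
    qPochInf_ne_zero (norm_mul_inv_lt_one_of_sphere h.c (hn z hz)) h.q⟩,
    qPochInf_ne_zero (norm_mul_lt_one_of_sphere h.d (hn z hz)) h.q⟩,
    qPochInf_ne_zero (norm_mul_inv_lt_one_of_sphere h.d (hn z hz)) h.q⟩

lemma InDisc.circleIntegrable {a b c d q : ℂ} (h : InDisc a b c d q) {f : ℂ → ℂ}
    (hf : Continuous f) :
    CircleIntegrable (fun z => awWeight a b c d q z * f ((z + z⁻¹) / 2)) 0 1 := by
  refine ContinuousOn.circleIntegrable zero_le_one (h.continuousOn_awWeight.mul ?_)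
  refine hf.comp_continuousOn ((continuousOn_id.add ?_).div_const 2)
  exact continuousOn_id.inv₀ fun z hz => Metric.ne_of_mem_sphere hz one_ne_zero

lemma InDisc.awIntegral_add {a b c d q : ℂ} (h : InDisc a b c d q) {f g : ℂ → ℂ}
    (hf : Continuous f) (hg : Continuous g) :
    awIntegral a b c d q (fun x => f x + g x) =
      awIntegral a b c d q f + awIntegral a b c d q g := by
  simp only [awIntegral_eq, mul_add]
  rw [circleAverage_fun_add (h.circleIntegrable hf) (h.circleIntegrable hg), mul_add]

lemma awIntegral_const_mul (a b c d q r : ℂ) (f : ℂ → ℂ) :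
    awIntegral a b c d q (fun x => r * f x) = r * awIntegral a b c d q f := by
  simp only [awIntegral_eq]
  have : ∀ z, awWeight a b c d q z * (r * f ((z + z⁻¹) / 2)) =
      r • (awWeight a b c d q z * f ((z + z⁻¹) / 2)) := fun z => by rw [smul_eq_mul]; ring
  simp only [this]
  rw [circleAverage_fun_smul, smul_eq_mul]
  ring

/-! ### The first moment and the shift of a parameter -/

/-- Rotation invariance of circle averages. -/
lemma circleAverage_comp_mul (f : ℂ → ℂ) (q : ℂ) :
    circleAverage (fun z => f (q * z)) 0 1 = circleAverage f 0 ‖q‖ := by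
  rw [circleAverage_eq_integral_add (Complex.arg q) (R := ‖q‖), circleAverage]
  congr 1
  refine intervalIntegral.integral_congr fun θ _ => congrArg f ?_
  conv_lhs => rw [← Complex.norm_mul_exp_arg_mul_I q]
  simp only [circleMap, zero_add, Complex.ofReal_one, one_mul, Complex.ofReal_add]
  rw [mul_assoc, ← Complex.exp_add]
  congr 2
  ring

/-- If `f` is holomorphic on the annulus `|q| ≤ |z| ≤ 1`, then `f(z)` and `f(q z)` have the same
average over the unit circle. -/
lemma circleAverage_eq_comp_mul {f : ℂ → ℂ} {q : ℂ} (hq0 : q ≠ 0) (hq : ‖q‖ < 1)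
    (hf : ∀ z, ‖q‖ ≤ ‖z‖ → ‖z‖ ≤ 1 → DifferentiableAt ℂ f z) :
    circleAverage f 0 1 = circleAverage (fun z => f (q * z)) 0 1 := by
  have h0 : 0 < ‖q‖ := norm_pos_iff.mpr hq0
  rw [circleAverage_comp_mul, circleAverage_eq_circleIntegral one_ne_zero,
    circleAverage_eq_circleIntegral h0.ne']
  congr 1
  refine Complex.circleIntegral_sub_center_inv_smul_eq_of_differentiable_on_annulus_off_countable
    h0 hq.le Set.countable_empty (fun z hz => ?_) (fun z hz => ?_)
  · simp only [Set.mem_sdiff, Metric.mem_closedBall, dist_zero_right, Metric.mem_ball, not_lt] at hz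
    exact (hf z hz.2 hz.1).continuousAt.continuousWithinAt
  · simp only [Set.mem_sdiff, Metric.mem_closedBall, dist_zero_right, Metric.mem_ball, not_le,
      Set.mem_empty_iff_false, not_false_eq_true, and_true] at hz
    exact hf z hz.2.le hz.1.le

/-- The function whose `q`-difference along the unit circle is the weight times the first
Askey-Wilson polynomial, see `InDisc.awPrimitive_sub`. -/
noncomputable def awPrimitive (a b c d q z : ℂ) : ℂ :=
  z * (qPochInf (z ^ 2) q * qPochInf (q * z⁻¹ ^ 2) q) /
    (qPochInf (a * z) q * qPochInf (a * q * z⁻¹) q * qPochInf (b * z) q * qPochInf (b * q * z⁻¹) q *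
      qPochInf (c * z) q * qPochInf (c * q * z⁻¹) q * qPochInf (d * z) q * qPochInf (d * q * z⁻¹) q)

lemma InDisc.differentiableAt_awPrimitive {a b c d q : ℂ} (h : InDisc a b c d q) (hq : q ≠ 0)
    {z : ℂ} (h1 : ‖q‖ ≤ ‖z‖) (h2 : ‖z‖ ≤ 1) : DifferentiableAt ℂ (awPrimitive a b c d q) z := by
  have hz : z ≠ 0 := norm_pos_iff.mp ((norm_pos_iff.mpr hq).trans_le h1)
  have hinv : DifferentiableAt ℂ (fun z : ℂ => z⁻¹) z := differentiableAt_inv hz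
  have P : ∀ {g : ℂ → ℂ}, DifferentiableAt ℂ g z →
      DifferentiableAt ℂ (fun z => qPochInf (g z) q) z := fun hg =>
    ((differentiable_qPochInf h.q) _).comp z hg
  have Pz : ∀ r : ℂ, DifferentiableAt ℂ (fun z => qPochInf (r * z) q) z := fun r =>
    P (differentiableAt_id.const_mul r)
  have Pi : ∀ r : ℂ, DifferentiableAt ℂ (fun z => qPochInf (r * z⁻¹) q) z := fun r =>
    P (hinv.const_mul r)
  have nz : ∀ r : ℂ, ‖r‖ < 1 → qPochInf (r * z) q ≠ 0 := fun r hr => by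
    refine qPochInf_ne_zero ?_ h.q
    rw [norm_mul]
    exact (mul_le_of_le_one_right (norm_nonneg r) h2).trans_lt hr
  have ni : ∀ r : ℂ, ‖r‖ < 1 → qPochInf (r * q * z⁻¹) q ≠ 0 := fun r hr => by
    refine qPochInf_ne_zero ?_ h.q
    rw [mul_assoc, norm_mul, norm_mul, norm_inv]
    refine (mul_le_of_le_one_right (norm_nonneg r) ?_).trans_lt hr
    rw [← div_eq_mul_inv]
    exact div_le_one_of_le₀ h1 (norm_nonneg z)
  refine DifferentiableAt.div (differentiableAt_id.mul ((P (differentiableAt_id.pow 2)).mul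
    (P ((hinv.pow 2).const_mul q)))) ((((((((Pz a).mul (Pi (a * q))).mul (Pz b)).mul
      (Pi (b * q))).mul (Pz c)).mul (Pi (c * q))).mul (Pz d)).mul (Pi (d * q))) ?_
  simp only [mul_ne_zero_iff]
  exact ⟨⟨⟨⟨⟨⟨⟨nz a h.a, ni a h.a⟩, nz b h.b⟩, ni b h.b⟩, nz c h.c⟩, ni c h.c⟩, nz d h.d⟩, ni d h.d⟩

lemma InDisc.awPrimitive_sub {a b c d q : ℂ} (h : InDisc a b c d q) (hq : q ≠ 0) {z : ℂ}
    (hz : ‖z‖ = 1) : awPrimitive a b c d q z - awPrimitive a b c d q (q * z) =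
      awH0 a b c d q * (awWeight a b c d q z * ((1 - a * b * c * d) * (2 * ((z + z⁻¹) / 2)) -
        (a + b + c + d - (a * b * c + a * b * d + a * c * d + b * c * d)))) := by
  have hz0 : z ≠ 0 := fun e => by simp [e] at hz
  have h0 := h.awH0_ne_zero
  have hq' := h.q
  rw [awPrimitive, awPrimitive, awWeight]
  -- all factors are expressed by those that are shifted by `q`
  have e1 : qPochInf (z ^ 2) q = (1 - z ^ 2) * ((1 - q * z ^ 2) *
      qPochInf ((q * z) ^ 2) q) := by
    rw [qPochInf_eq_mul _ hq', qPochInf_eq_mul (z ^ 2 * q) hq']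
    ring_nf
  have e2 : qPochInf (z⁻¹ ^ 2) q = (1 - z⁻¹ ^ 2) * qPochInf (q * z⁻¹ ^ 2) q := by
    rw [qPochInf_eq_mul _ hq', mul_comm q]
  have e3 : qPochInf (q * (q * z)⁻¹ ^ 2) q =
      (1 - q⁻¹ * z⁻¹ ^ 2) * ((1 - z⁻¹ ^ 2) * qPochInf (q * z⁻¹ ^ 2) q) := by
    have : q * (q * z)⁻¹ ^ 2 = q⁻¹ * z⁻¹ ^ 2 := by field_simp
    rw [this, qPochInf_eq_mul _ hq', ← e2]
    congr 2
    field_simp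
  have ez : ∀ r : ℂ, qPochInf (r * z) q = (1 - r * z) * qPochInf (r * (q * z)) q := fun r => by
    rw [qPochInf_eq_mul _ hq']; ring_nf
  have ei : ∀ r : ℂ, qPochInf (r * z⁻¹) q = (1 - r * z⁻¹) * qPochInf (r * q * z⁻¹) q := fun r => by
    rw [qPochInf_eq_mul _ hq']; ring_nf
  have eq : ∀ r : ℂ, qPochInf (r * q * (q * z)⁻¹) q = qPochInf (r * z⁻¹) q := fun r => by
    congr 1; field_simp
  have nz : ∀ r : ℂ, ‖r‖ < 1 → 1 - r * z ≠ 0 ∧ qPochInf (r * (q * z)) q ≠ 0 := fun r hr => by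
    rw [← mul_ne_zero_iff, ← ez]
    exact qPochInf_ne_zero (norm_mul_lt_one_of_sphere hr hz) hq'
  have ni : ∀ r : ℂ, ‖r‖ < 1 → 1 - r * z⁻¹ ≠ 0 ∧ qPochInf (r * q * z⁻¹) q ≠ 0 := fun r hr => by
    rw [← mul_ne_zero_iff, ← ei]
    exact qPochInf_ne_zero (norm_mul_inv_lt_one_of_sphere hr hz) hq'
  rw [eq, eq, eq, eq, e3, e1, e2, ez a, ez b, ez c, ez d, ei a, ei b, ei c, ei d]
  obtain ⟨a1, a2⟩ := nz a h.a
  obtain ⟨a3, a4⟩ := ni a h.a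
  obtain ⟨b1, b2⟩ := nz b h.b
  obtain ⟨b3, b4⟩ := ni b h.b
  obtain ⟨c1, c2⟩ := nz c h.c
  obtain ⟨c3, c4⟩ := ni c h.c
  obtain ⟨d1, d2⟩ := nz d h.d
  obtain ⟨d3, d4⟩ := ni d h.d
  generalize awH0 a b c d q = H at *
  generalize qPochInf (a * (q * z)) q = A1 at *
  generalize qPochInf (b * (q * z)) q = B1 at *
  generalize qPochInf (c * (q * z)) q = C1 at *
  generalize qPochInf (d * (q * z)) q = D1 at *
  generalize qPochInf (a * q * z⁻¹) q = A2 at *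
  generalize qPochInf (b * q * z⁻¹) q = B2 at *
  generalize qPochInf (c * q * z⁻¹) q = C2 at *
  generalize qPochInf (d * q * z⁻¹) q = D2 at *
  generalize qPochInf ((q * z) ^ 2) q = S at *
  generalize qPochInf (q * z⁻¹ ^ 2) q = T at *
  -- the common factor of the three terms
  have hG : ∀ N : ℂ, N / (H * ((1 - a * z) * A1 * ((1 - a * z⁻¹) * A2) * ((1 - b * z) * B1) *
      ((1 - b * z⁻¹) * B2) * ((1 - c * z) * C1) * ((1 - c * z⁻¹) * C2) * ((1 - d * z) * D1) *
      ((1 - d * z⁻¹) * D2))) = N * (H⁻¹ * ((1 - a * z)⁻¹ * (1 - a * z⁻¹)⁻¹ * (1 - b * z)⁻¹ *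
        (1 - b * z⁻¹)⁻¹ * (1 - c * z)⁻¹ * (1 - c * z⁻¹)⁻¹ * (1 - d * z)⁻¹ * (1 - d * z⁻¹)⁻¹) *
        (A1 * A2 * B1 * B2 * C1 * C2 * D1 * D2)⁻¹) := fun N => by
    rw [div_eq_mul_inv]; simp only [mul_inv]; ring
  rw [hG]
  set G := (A1 * A2 * B1 * B2 * C1 * C2 * D1 * D2)⁻¹ with hGdef
  have k1 : z * ((1 - z ^ 2) * ((1 - q * z ^ 2) * S) * T) / ((1 - a * z) * A1 * A2 *
      ((1 - b * z) * B1) * B2 * ((1 - c * z) * C1) * C2 * ((1 - d * z) * D1) * D2) =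
      z * (1 - z ^ 2) * (1 - q * z ^ 2) * S * T * G * ((1 - a * z)⁻¹ * (1 - b * z)⁻¹ *
        (1 - c * z)⁻¹ * (1 - d * z)⁻¹) := by
    rw [div_eq_mul_inv, hGdef]; simp only [mul_inv]; ring
  have k2 : q * z * (S * ((1 - q⁻¹ * z⁻¹ ^ 2) * ((1 - z⁻¹ ^ 2) * T))) / (A1 * ((1 - a * z⁻¹) * A2) *
      B1 * ((1 - b * z⁻¹) * B2) * C1 * ((1 - c * z⁻¹) * C2) * D1 * ((1 - d * z⁻¹) * D2)) =
      q * z * (1 - q⁻¹ * z⁻¹ ^ 2) * (1 - z⁻¹ ^ 2) * S * T * G * ((1 - a * z⁻¹)⁻¹ *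
        (1 - b * z⁻¹)⁻¹ * (1 - c * z⁻¹)⁻¹ * (1 - d * z⁻¹)⁻¹) := by
    rw [div_eq_mul_inv, hGdef]; simp only [mul_inv]; ring
  rw [k1, k2]
  have k3 : q * z * (1 - q⁻¹ * z⁻¹ ^ 2) = - z⁻¹ * (1 - q * z ^ 2) := by field_simp; ring
  rw [k3]
  -- only a rational identity in `z` is left
  have k4 : z * (1 - z ^ 2) * ((1 - a * z)⁻¹ * (1 - b * z)⁻¹ * (1 - c * z)⁻¹ * (1 - d * z)⁻¹) +
      z⁻¹ * (1 - z⁻¹ ^ 2) * ((1 - a * z⁻¹)⁻¹ * (1 - b * z⁻¹)⁻¹ * (1 - c * z⁻¹)⁻¹ *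
        (1 - d * z⁻¹)⁻¹) = (1 - z ^ 2) * (1 - z⁻¹ ^ 2) * ((1 - a * b * c * d) *
          (2 * ((z + z⁻¹) / 2)) - (a + b + c + d - (a * b * c + a * b * d + a * c * d +
          b * c * d))) * ((1 - a * z)⁻¹ * (1 - a * z⁻¹)⁻¹ * (1 - b * z)⁻¹ *
        (1 - b * z⁻¹)⁻¹ * (1 - c * z)⁻¹ * (1 - c * z⁻¹)⁻¹ * (1 - d * z)⁻¹ * (1 - d * z⁻¹)⁻¹) := by
    have p : z * (1 - z ^ 2) * ((1 - a * z⁻¹) * (1 - b * z⁻¹) * (1 - c * z⁻¹) * (1 - d * z⁻¹)) +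
        z⁻¹ * (1 - z⁻¹ ^ 2) * ((1 - a * z) * (1 - b * z) * (1 - c * z) * (1 - d * z)) =
        (1 - z ^ 2) * (1 - z⁻¹ ^ 2) * ((1 - a * b * c * d) * (2 * ((z + z⁻¹) / 2)) -
          (a + b + c + d - (a * b * c + a * b * d + a * c * d + b * c * d))) := by
      field_simp
      ring
    rw [← p]
    have u := mul_inv_cancel₀ (mul_ne_zero (mul_ne_zero (mul_ne_zero a1 b1) c1) d1)
    have v := mul_inv_cancel₀ (mul_ne_zero (mul_ne_zero (mul_ne_zero a3 b3) c3) d3)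
    simp only [mul_inv] at u v
    linear_combination -z * (1 - z ^ 2) * ((1 - a * z)⁻¹ * (1 - b * z)⁻¹ * (1 - c * z)⁻¹ *
      (1 - d * z)⁻¹) * v - z⁻¹ * (1 - z⁻¹ ^ 2) * ((1 - a * z⁻¹)⁻¹ * (1 - b * z⁻¹)⁻¹ *
      (1 - c * z⁻¹)⁻¹ * (1 - d * z⁻¹)⁻¹) * u
  have k5 : H * H⁻¹ = 1 := mul_inv_cancel₀ h0
  linear_combination (1 - q * z ^ 2) * S * T * G * k4 - (1 - z ^ 2) * (1 - z⁻¹ ^ 2) *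
    ((1 - a * b * c * d) *
          (2 * ((z + z⁻¹) / 2)) - (a + b + c + d - (a * b * c + a * b * d + a * c * d +
          b * c * d))) * ((1 - a * z)⁻¹ * (1 - a * z⁻¹)⁻¹ * (1 - b * z)⁻¹ *
        (1 - b * z⁻¹)⁻¹ * (1 - c * z)⁻¹ * (1 - c * z⁻¹)⁻¹ * (1 - d * z)⁻¹ * (1 - d * z⁻¹)⁻¹) *
    (1 - q * z ^ 2) * S * T * G * k5

/-- The first Askey-Wilson polynomial has integral zero. -/
lemma InDisc.awIntegral_two_mul {a b c d q : ℂ} (h : InDisc a b c d q) (hq : q ≠ 0) :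
    (1 - a * b * c * d) * awIntegral a b c d q (fun x => 2 * x) =
      (a + b + c + d - (a * b * c + a * b * d + a * c * d + b * c * d)) *
        awIntegral a b c d q (fun _ => 1) := by
  have hH : ∀ z, ‖q‖ ≤ ‖z‖ → ‖z‖ ≤ 1 → DifferentiableAt ℂ (awPrimitive a b c d q) z :=
    fun z h1 h2 => h.differentiableAt_awPrimitive hq h1 h2
  have hn : ∀ z ∈ Metric.sphere (0 : ℂ) 1, ‖z‖ = 1 := fun z hz => by simpa using hz
  have i1 : CircleIntegrable (awPrimitive a b c d q) 0 1 :=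
    ContinuousOn.circleIntegrable zero_le_one fun z hz =>
      (hH z ((hn z hz).symm ▸ h.q.le) (hn z hz).le).continuousAt.continuousWithinAt
  have i2 : CircleIntegrable (fun z => awPrimitive a b c d q (q * z)) 0 1 := by
    refine ContinuousOn.circleIntegrable zero_le_one fun z hz => ?_
    have : ‖q * z‖ = ‖q‖ := by rw [norm_mul, hn z hz, mul_one]
    exact ((hH (q * z) this.ge (this ▸ h.q.le)).comp z
      (differentiableAt_id.const_mul q)).continuousAt.continuousWithinAt
  have key := circleAverage_eq_comp_mul hq h.q hH
  rw [← sub_eq_zero, ← circleAverage_fun_sub i1 i2] at key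
  have hc : circleAverage (fun z => awPrimitive a b c d q z - awPrimitive a b c d q (q * z)) 0 1 =
      awH0 a b c d q * circleAverage (fun z => awWeight a b c d q z *
        ((1 - a * b * c * d) * (2 * ((z + z⁻¹) / 2)) -
          (a + b + c + d - (a * b * c + a * b * d + a * c * d + b * c * d)))) 0 1 := by
    rw [← smul_eq_mul (awH0 a b c d q), ← circleAverage_fun_smul]
    refine circleAverage_congr_sphere fun z hz => ?_
    rw [abs_one] at hz
    exact h.awPrimitive_sub hq (hn z hz)
  rw [hc, mul_eq_zero, or_iff_right h.awH0_ne_zero] at key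
  generalize 1 - a * b * c * d = A at *
  generalize a + b + c + d - (a * b * c + a * b * d + a * c * d + b * c * d) = B at *
  have e := awIntegral_eq a b c d q fun x => A * (2 * x) - B
  simp only [key, mul_zero] at e
  have e' := h.awIntegral_add (f := fun x => A * (2 * x)) (g := fun _ => -B * 1)
    (by fun_prop) (by fun_prop)
  rw [awIntegral_const_mul a b c d q A fun x => 2 * x,
    awIntegral_const_mul a b c d q (-B) fun _ => 1] at e'
  simp only [mul_one, ← sub_eq_add_neg, e] at e'
  linear_combination -e'

lemma awWeight_shift {a b c d q z : ℂ} (h : InDisc a b c d q) (hz : ‖z‖ = 1) :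
    awWeight a b c d q z * (1 - 2 * a * ((z + z⁻¹) / 2) + a ^ 2) =
      (1 - a * b) * (1 - a * c) * (1 - a * d) / (1 - a * b * c * d) *
        awWeight (a * q) b c d q z := by
  have hz0 : z ≠ 0 := fun e => by simp [e] at hz
  have hq := h.q
  have e : ∀ r s : ℂ, s = a * r → qPochInf s q = (1 - a * r) * qPochInf (a * q * r) q := by
    rintro r _ rfl
    rw [qPochInf_eq_mul _ hq]; ring_nf
  have e0 : qPochInf (a * b * c * d) q =
      (1 - a * b * c * d) * qPochInf (a * q * b * c * d) q := by
    rw [qPochInf_eq_mul _ hq]; ring_nf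
  have ha : ∀ r : ℂ, ‖a * r‖ < 1 → 1 - a * r ≠ 0 := fun r hr e => by
    rw [← sub_eq_zero.mp e, norm_one] at hr
    exact lt_irrefl _ hr
  have n0 : 1 - a * b * c * d ≠ 0 := by
    have := ha (b * c * d) (norm_mul_lt_one h.a (norm_mul_lt_one (norm_mul_lt_one h.b h.c) h.d))
    convert this using 1; ring
  have nb := ha b (norm_mul_lt_one h.a h.b)
  have nc := ha c (norm_mul_lt_one h.a h.c)
  have nd := ha d (norm_mul_lt_one h.a h.d)
  have nz := ha z (norm_mul_lt_one_of_sphere h.a hz)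
  have ni := ha z⁻¹ (norm_mul_inv_lt_one_of_sphere h.a hz)
  have hx : 1 - 2 * a * ((z + z⁻¹) / 2) + a ^ 2 = (1 - a * z) * (1 - a * z⁻¹) := by
    field_simp
    ring
  rw [hx, awWeight, awWeight, awH0, awH0, e0, e b _ rfl, e c _ rfl, e d _ rfl, e z _ rfl,
    e z⁻¹ _ rfl]
  simp only [div_eq_mul_inv, mul_inv, inv_inv]
  have u0 := mul_inv_cancel₀ nz
  have u1 := mul_inv_cancel₀ ni
  generalize (1 - a * z)⁻¹ = v0 at *
  generalize (1 - a * z⁻¹)⁻¹ = v1 at *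
  have hv : (1 - a * z) * (1 - a * z⁻¹) * (v0 * v1) = 1 := by
    linear_combination (1 - a * z⁻¹) * v1 * u0 + u1
  generalize (1 - a * z) = w0 at *
  generalize (1 - a * z⁻¹) = w1 at *
  generalize (1 - a * b * c * d)⁻¹ = w2 at *
  generalize (1 - a * b) = w3 at *
  generalize (1 - a * c) = w4 at *
  generalize (1 - a * d) = w5 at *
  refine Eq.trans ?_ ((congrArg (HMul.hMul _) hv).trans (mul_one _))
  ring

lemma InDisc.shift {a b c d q : ℂ} (h : InDisc a b c d q) : InDisc (a * q) b c d q :=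
  ⟨h.q, norm_mul_lt_one h.a h.q, h.b, h.c, h.d⟩

/-- The analogue of `awL_shift` for the integral. -/
lemma awIntegral_shift {a b c d q : ℂ} (h : InDisc a b c d q) (f : ℂ → ℂ) :
    awIntegral a b c d q (fun x => (1 - 2 * a * x + a ^ 2) * f x) =
      (1 - a * b) * (1 - a * c) * (1 - a * d) / (1 - a * b * c * d) *
        awIntegral (a * q) b c d q f := by
  set r := (1 - a * b) * (1 - a * c) * (1 - a * d) / (1 - a * b * c * d) with hr
  rw [awIntegral_eq, awIntegral_eq, mul_left_comm, ← smul_eq_mul r, ← circleAverage_fun_smul]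
  congr 1
  refine circleAverage_congr_sphere fun z hz => ?_
  have hz' : ‖z‖ = 1 := by simpa using hz
  rw [← mul_assoc, awWeight_shift h hz', smul_eq_mul, mul_assoc]

/-! ### The total mass -/

lemma one_sub_ne_zero_of_norm_lt_one {r : ℂ} (hr : ‖r‖ < 1) : 1 - r ≠ 0 := fun e => by
  rw [← sub_eq_zero.mp e, norm_one] at hr
  exact lt_irrefl _ hr

/-- The integral of `1 - 2 a x + a²` is known in terms of the total mass for `a` by the first
moment, and in terms of the one for `a q` by the shift. -/
lemma InDisc.awIntegral_one_shift {a b c d q : ℂ} (h : InDisc a b c d q) (hq : q ≠ 0) :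
    awIntegral (a * q) b c d q (fun _ => 1) = awIntegral a b c d q (fun _ => 1) := by
  have h1 := awIntegral_shift h fun _ => 1
  have h2 := h.awIntegral_two_mul hq
  have h3 := h.awIntegral_add (f := fun x => (-a) * (2 * x)) (g := fun x => (1 + a ^ 2) * 1)
    (by fun_prop) (by fun_prop)
  rw [awIntegral_const_mul a b c d q (-a) fun x => 2 * x,
    awIntegral_const_mul a b c d q (1 + a ^ 2) fun _ => 1] at h3
  have h4 : (fun x : ℂ => (1 - 2 * a * x + a ^ 2) * 1) =
      fun x => (-a) * (2 * x) + (1 + a ^ 2) * 1 := by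
    funext x; ring
  rw [h4, h3] at h1
  have n0 := one_sub_ne_zero_of_norm_lt_one
    (norm_mul_lt_one (norm_mul_lt_one (norm_mul_lt_one h.a h.b) h.c) h.d)
  have nb := one_sub_ne_zero_of_norm_lt_one (norm_mul_lt_one h.a h.b)
  have nc := one_sub_ne_zero_of_norm_lt_one (norm_mul_lt_one h.a h.c)
  have nd := one_sub_ne_zero_of_norm_lt_one (norm_mul_lt_one h.a h.d)
  rw [div_mul_eq_mul_div, eq_div_iff n0] at h1
  refine mul_left_cancel₀ (mul_ne_zero (mul_ne_zero nb nc) nd) ?_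
  linear_combination -h1 - a * h2

lemma awIntegral_swap_ab (a b c d q : ℂ) (f : ℂ → ℂ) :
    awIntegral a b c d q f = awIntegral b a c d q f := by
  have e : awWeight a b c d q = awWeight b a c d q := by
    funext z
    simp only [awWeight, awH0, mul_comm b a]
    ring_nf
  rw [awIntegral, awIntegral, e]

lemma awIntegral_swap_ac (a b c d q : ℂ) (f : ℂ → ℂ) :
    awIntegral a b c d q f = awIntegral c b a d q f := by
  have e : awWeight a b c d q = awWeight c b a d q := by
    funext z
    simp only [awWeight, awH0, mul_comm c b, mul_comm b a, mul_comm c a]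
    ring_nf
  rw [awIntegral, awIntegral, e]

lemma awIntegral_swap_ad (a b c d q : ℂ) (f : ℂ → ℂ) :
    awIntegral a b c d q f = awIntegral d b c a q f := by
  have e : awWeight a b c d q = awWeight d b c a q := by
    funext z
    simp only [awWeight, awH0, mul_comm d b, mul_comm d c, mul_comm b a, mul_comm d a,
      mul_comm c a]
    ring_nf
  rw [awIntegral, awIntegral, e]

lemma InDisc.awIntegral_one_zero {a b c d q : ℂ} (h : InDisc a b c d q) (hq : q ≠ 0) :
    awIntegral a b c d q (fun _ => 1) = awIntegral 0 b c d q (fun _ => 1) := by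
  have hF : Continuous fun x : Metric.ball (0 : ℂ) 1 => awIntegral x b c d q fun _ => 1 :=
    continuous_awIntegral continuous_subtype_val continuous_const continuous_const
      continuous_const continuous_const
      (fun x => ⟨h.q, mem_ball_zero_iff.mp x.2, h.b, h.c, h.d⟩) continuous_const
  have hn : ∀ n : ℕ, ‖a * q ^ n‖ < 1 := fun n => by
    rw [norm_mul, norm_pow]
    exact (mul_le_of_le_one_right (norm_nonneg a) (pow_le_one₀ (norm_nonneg q) h.q.le)).trans_lt h.a
  have hc := (continuousOn_iff_continuous_domRestrict (f := fun x =>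
    awIntegral x b c d q fun _ => 1).mpr hF).continuousAt
    (Metric.ball_mem_nhds (0 : ℂ) one_pos)
  have hlim : Tendsto (fun n : ℕ => a * q ^ n) atTop (𝓝 0) := by
    simpa using (tendsto_pow_atTop_nhds_zero_of_norm_lt_one h.q).const_mul a
  have hconst : ∀ n : ℕ, awIntegral (a * q ^ n) b c d q (fun _ => 1) =
      awIntegral a b c d q (fun _ => 1) := by
    intro n
    induction n with
    | zero => rw [pow_zero, mul_one]
    | succ n ih =>
      have hd : InDisc (a * q ^ n) b c d q := ⟨h.q, hn n, h.b, h.c, h.d⟩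
      rw [pow_succ, ← mul_assoc, hd.awIntegral_one_shift hq, ih]
  refine tendsto_nhds_unique ?_ (hc.tendsto.comp hlim)
  simp only [Function.comp_def, hconst]
  exact tendsto_const_nhds

/-- The Askey-Wilson integral for the parameters for which the weight is elementary. -/
lemma awIntegral_one_special {r : ℂ} (hr : ‖r‖ < 1) :
    awIntegral (r ^ 2) (-r ^ 2) r (-r) (r ^ 2) (fun _ => 1) = 1 := by
  have hq : ‖r ^ 2‖ < 1 := by rw [norm_pow]; exact pow_lt_one₀ (norm_nonneg r) hr two_ne_zero
  have hq2 : ‖(r ^ 2) ^ 2‖ < 1 := by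
    rw [norm_pow]; exact pow_lt_one₀ (norm_nonneg _) hq two_ne_zero
  have hr' : ‖-r‖ < 1 := by rwa [norm_neg]
  have hq' : ‖-r ^ 2‖ < 1 := by rwa [norm_neg]
  have h : InDisc (r ^ 2) (-r ^ 2) r (-r) (r ^ 2) := ⟨hq, hq, hq', hr, hr'⟩
  have N : ∀ x : ℂ, qPochInf (r ^ 2 * x) (r ^ 2) * qPochInf (-r ^ 2 * x) (r ^ 2) *
      (qPochInf (r * x) (r ^ 2) * qPochInf (-r * x) (r ^ 2)) =
      qPochInf (r ^ 2 * x ^ 2) (r ^ 2) := fun x => by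
    rw [neg_mul, neg_mul, qPochInf_mul_neg _ hq, qPochInf_mul_neg _ hq,
      ← qPochInf_even_mul_odd (r ^ 2 * x ^ 2) hq, mul_comm]
    congr 2 <;> ring
  -- the normalization is trivial, by Euler's identity
  have hH : awH0 (r ^ 2) (-r ^ 2) r (-r) (r ^ 2) = 1 := by
    have hA := qPochInf_ne_zero hq hq
    have hB := qPochInf_ne_zero hq' hq
    have e1 := qPochInf_mul_neg (r ^ 2) hq
    have e2 := qPochInf_even_mul_odd (r ^ 2) hq
    have e3 := qPochInf_eq_mul (r ^ 2) hq2
    have e4 := qPochInf_eq_mul (-r ^ 2) hq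
    have e5 := qPochInf_eq_mul (r ^ 2) hq
    have e6 := qPochInf_eq_mul (r ^ 2 * r ^ 2) hq
    have e7 := qPochInf_mul_neg (r ^ 3) hq
    have h4 : ‖-r ^ 2 * r ^ 2‖ < 1 := norm_mul_lt_one hq' hq
    have n4 := qPochInf_ne_zero h4 hq
    have h3 : ‖r ^ 3‖ < 1 := by rw [norm_pow]; exact pow_lt_one₀ (norm_nonneg r) hr three_ne_zero
    have n3 := qPochInf_ne_zero h3 hq
    have n3' : qPochInf (-r ^ 3) (r ^ 2) ≠ 0 := qPochInf_ne_zero (by rwa [norm_neg]) hq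
    have n1 := one_sub_ne_zero_of_norm_lt_one hq
    have n2 := one_sub_ne_zero_of_norm_lt_one (norm_mul_lt_one hq hq)
    rw [awH0, show r ^ 2 * -r ^ 2 * r * -r = r ^ 2 * r ^ 2 * r ^ 2 by ring,
      show r ^ 2 * -r ^ 2 = -r ^ 2 * r ^ 2 by ring, show r ^ 2 * r = r ^ 3 by ring,
      show r ^ 2 * -r = -r ^ 3 by ring, show -r ^ 2 * r = -r ^ 3 by ring,
      show -r ^ 2 * -r = r ^ 3 by ring, show r * -r = -r ^ 2 by ring, div_eq_one_iff_eq
      (by simp only [mul_ne_zero_iff]; tauto)]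
    rw [show r ^ 2 * (r ^ 2) ^ 2 = (r ^ 3) ^ 2 by ring] at e3
    rw [show r ^ 2 * r ^ 2 = (r ^ 2) ^ 2 by ring] at *
    generalize qPochInf (r ^ 2) (r ^ 2) = A at *
    generalize qPochInf (-r ^ 2) (r ^ 2) = B at *
    generalize qPochInf (r ^ 2) ((r ^ 2) ^ 2) = O at *
    generalize qPochInf ((r ^ 2) ^ 2) ((r ^ 2) ^ 2) = E at *
    generalize qPochInf ((r ^ 3) ^ 2) ((r ^ 2) ^ 2) = Y at *
    generalize qPochInf (r ^ 3) (r ^ 2) = Y1 at *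
    generalize qPochInf (-r ^ 3) (r ^ 2) = Y2 at *
    have hBO : B * O = 1 := mul_left_cancel₀ hA (by linear_combination O * e1 + e2)
    refine mul_left_cancel₀ (mul_ne_zero n1 n2) ?_
    generalize qPochInf (-r ^ 2 * r ^ 2) (r ^ 2) = P at *
    generalize qPochInf ((r ^ 2) ^ 2 * r ^ 2) (r ^ 2) = Q at *
    generalize qPochInf ((r ^ 2) ^ 2) (r ^ 2) = Q' at *
    have t1 : (1 - r ^ 2) * (1 - (r ^ 2) ^ 2) * Q = A := by rw [e5, e6]; ring
    have t2 : (1 - r ^ 2) * (1 - (r ^ 2) ^ 2) * (A * P * Y1 * Y2 * Y2 * Y1 * B) =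
        A * B * B * O ^ 2 := by
      linear_combination A * B * ((1 + r ^ 2) * P) * ((1 - r ^ 2) * (Y1 * Y2) + O) *
        ((1 - r ^ 2) * e7 - e3) - A * B * O ^ 2 * e4
    rw [t1, t2]
    linear_combination -A * (B * O + 1) * hBO
  have hw : ∀ z : ℂ, ‖z‖ = 1 → awWeight (r ^ 2) (-r ^ 2) r (-r) (r ^ 2) z =
      (1 - z ^ 2) * (1 - z⁻¹ ^ 2) := by
    intro z hz
    have n : ∀ x : ℂ, ‖x‖ = 1 → qPochInf (r ^ 2 * x ^ 2) (r ^ 2) ≠ 0 := fun x hx =>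
      qPochInf_ne_zero (norm_mul_lt_one_of_sphere hq (by rw [norm_pow, hx, one_pow])) hq
    have hzi : ‖z⁻¹‖ = 1 := by rw [norm_inv, hz, inv_one]
    have n1 := n z hz
    have n2 := n z⁻¹ hzi
    rw [awWeight, hH, one_mul, qPochInf_eq_mul (z ^ 2) hq, qPochInf_eq_mul (z⁻¹ ^ 2) hq,
      mul_comm (z ^ 2), mul_comm (z⁻¹ ^ 2), div_eq_iff]
    · rw [← N z, ← N z⁻¹]
      ring
    · rw [← N z] at n1
      rw [← N z⁻¹] at n2
      simp only [mul_ne_zero_iff] at n1 n2 ⊢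
      tauto
  have hn : ∀ z ∈ Metric.sphere (0 : ℂ) |1|, ‖z‖ = 1 := fun z hz => by simpa using hz
  have hsq : circleAverage (fun z : ℂ => z ^ 2) 0 1 = 0 := by
    have := DiffContOnCl.circleAverage (f := fun z : ℂ => z ^ 2) (c := 0) (R := 1)
      (Differentiable.diffContOnCl (by fun_prop))
    simpa using this
  have hsqi : circleAverage (fun z : ℂ => z⁻¹ ^ 2) 0 1 = 0 := by
    refine Eq.trans ?_ hsq
    exact circleAverage_zero_one_congr_inv (f := fun z : ℂ => z ^ 2)
  have i1 : CircleIntegrable (fun z : ℂ => z ^ 2) 0 1 :=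
    ContinuousOn.circleIntegrable zero_le_one (by fun_prop)
  have i2 : CircleIntegrable (fun z : ℂ => z⁻¹ ^ 2) 0 1 :=
    ContinuousOn.circleIntegrable zero_le_one ((continuousOn_id.inv₀ fun z hz =>
      Metric.ne_of_mem_sphere hz one_ne_zero).pow 2)
  have e : circleAverage (fun z => awWeight (r ^ 2) (-r ^ 2) r (-r) (r ^ 2) z * 1) 0 1 =
      circleAverage (fun z : ℂ => 2 - (z ^ 2 + z⁻¹ ^ 2)) 0 1 := by
    refine circleAverage_congr_sphere fun z hz => ?_
    have hz0 : z ≠ 0 := fun e => by simpa [e] using hn z hz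
    simp only [hw z (hn z hz)]
    field_simp
    ring
  rw [awIntegral_eq, e, circleAverage_fun_sub (circleIntegrable_const _ _ _)
    (show CircleIntegrable (fun z : ℂ => z ^ 2 + z⁻¹ ^ 2) 0 1 from i1.add i2),
    circleAverage_fun_add i1 i2, hsq, hsqi, circleAverage_const]
  norm_num

/-- The normalization `awH0` is the integral of the weight (the Askey-Wilson integral): the total
mass does not change when the parameters are set to `0` one after the other, so it equals that at
`(q, -q, r, -r)` with `r² = q`. -/
lemma InDisc.awIntegral_one {a b c d q : ℂ} (h : InDisc a b c d q) (hq : q ≠ 0) :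
    awIntegral a b c d q (fun _ => 1) = 1 := by
  have h0 : ‖(0 : ℂ)‖ < 1 := by simp
  have red : ∀ a b c d : ℂ, InDisc a b c d q →
      awIntegral a b c d q (fun _ => 1) = awIntegral 0 0 0 0 q (fun _ => 1) := by
    intro a b c d h
    rw [h.awIntegral_one_zero hq, awIntegral_swap_ab,
      (⟨h.q, h.b, h0, h.c, h.d⟩ : InDisc b 0 c d q).awIntegral_one_zero hq, awIntegral_swap_ac,
      (⟨h.q, h.c, h0, h0, h.d⟩ : InDisc c 0 0 d q).awIntegral_one_zero hq, awIntegral_swap_ad,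
      (⟨h.q, h.d, h0, h0, h0⟩ : InDisc d 0 0 0 q).awIntegral_one_zero hq]
  obtain ⟨r, rfl⟩ := IsAlgClosed.exists_pow_nat_eq q two_pos
  have hr : ‖r‖ < 1 := by
    have := h.q
    rw [norm_pow] at this
    exact (sq_lt_one_iff₀ (norm_nonneg r)).mp this
  have hr' : ‖-r ^ 2‖ < 1 := by rw [norm_neg]; exact h.q
  rw [red a b c d h]
  exact (red (r ^ 2) (-r ^ 2) r (-r) ⟨h.q, h.q, hr', hr, by rwa [norm_neg]⟩).symm.trans
    (awIntegral_one_special hr)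

/-- The integral against the Askey-Wilson weight, as a functional on polynomials. -/
noncomputable def InDisc.integralL {a b c d q : ℂ} (h : InDisc a b c d q) : ℂ[X] →ₗ[ℂ] ℂ where
  toFun f := awIntegral a b c d q fun x => f.eval x
  map_add' f g := by
    simp only [eval_add]
    exact h.awIntegral_add f.continuous g.continuous
  map_smul' r f := by
    simp only [eval_smul, smul_eq_mul, RingHom.id_apply]
    exact awIntegral_const_mul a b c d q r _

lemma InDisc.integralL_apply {a b c d q : ℂ} (h : InDisc a b c d q) (f : ℂ[X]) :
    h.integralL f = awIntegral a b c d q fun x => f.eval x := rfl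

lemma InDisc.integralL_awPhi {a b c d q : ℂ} (h : InDisc a b c d q) (hq : q ≠ 0) (k : ℕ) :
    h.integralL (awPhi a q k) =
      qPoch (a * b) q k * qPoch (a * c) q k * qPoch (a * d) q k / qPoch (a * b * c * d) q k := by
  induction k generalizing a with
  | zero => simp [awPhi, qPoch_zero, h.integralL_apply, h.awIntegral_one hq]
  | succ k ih =>
    have e : (fun x : ℂ => (awPhi a q (k + 1)).eval x) =
        fun x => (1 - 2 * a * x + a ^ 2) * (awPhi (a * q) q k).eval x := by
      funext x
      rw [awPhi_succ]
      simp
    rw [h.integralL_apply, e, awIntegral_shift h, ← h.shift.integralL_apply, ih h.shift,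
      qPoch_succ', qPoch_succ', qPoch_succ', qPoch_succ', div_mul_div_comm]
    congr 1 <;> ring_nf

lemma InDisc.mul_pow_ne_one {a b c d q : ℂ} (h : InDisc a b c d q) (k : ℕ) :
    a * b * c * d * q ^ k ≠ 1 := fun e => by
  refine one_sub_ne_zero_of_norm_lt_one (r := a * b * c * d * q ^ k) ?_ (by rw [e, sub_self])
  rw [norm_mul, norm_pow]
  exact (mul_le_of_le_one_right (norm_nonneg _) (pow_le_one₀ (norm_nonneg q) h.q.le)).trans_lt
    (norm_mul_lt_one (norm_mul_lt_one (norm_mul_lt_one h.a h.b) h.c) h.d)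

/-! ### The tableaux and the Askey-Wilson functional -/

/-- The matrix ansatz in the oscillator module, with a scaling parameter `s`. -/
lemma matrixAnsatz_osc {a b c d q s α β γ δ : ℂ} (hs : s ≠ 0) (hq : q ≠ 1)
    (h : ∀ k : ℕ, a * b * c * d * q ^ k ≠ 1)
    (hα : α * ((1 + a * s) * (1 + c * s)) = 1 - q) (hβ : β * ((1 + b / s) * (1 + d / s)) = 1 - q)
    (hγ : γ = -α * (a * s * (c * s))) (hδ : δ = -β * (b / s * (d / s))) :
    MatrixAnsatz α β γ δ q
      ((1 - q)⁻¹ • (1 + s⁻¹ • LinearMap.mulLeft ℂ (X : ℂ[X])) : Module.End ℂ ℂ[X])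
      ((1 - q)⁻¹ • (1 + s • oscE a c q)) 1 (vacF a b c d q) := by
  have hq' : 1 - q ≠ 0 := sub_ne_zero.mpr hq.symm
  refine ⟨fun u => ?_, ?_, fun u => ?_, vacF_one a b c d q⟩
  · simp only [LinearMap.smul_apply, LinearMap.add_apply, Module.End.one_apply,
      LinearMap.mulLeft_apply, map_add, map_smul, oscE_X_mul, smul_add, smul_smul]
    match_scalars <;> field_simp <;> ring
  · simp only [LinearMap.smul_apply, LinearMap.add_apply, Module.End.one_apply,
      LinearMap.mulLeft_apply, oscE_one, mul_one]
    have k1 : α * ((1 - q)⁻¹ * (1 + s * (a + c))) = γ * (1 - q)⁻¹ + 1 := by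
      rw [hγ]
      field_simp
      linear_combination hα
    have k2 : α * ((1 - q)⁻¹ * (s * (a * c))) = -(γ * ((1 - q)⁻¹ * s⁻¹)) := by
      rw [hγ]
      field_simp
    have k1' := congrArg (C : ℂ →+* ℂ[X]) k1
    have k2' := congrArg (C : ℂ →+* ℂ[X]) k2
    simp only [map_mul, map_add, map_neg, map_one] at k1' k2'
    simp only [smul_eq_C_mul, map_mul, map_add]
    linear_combination k1' - X * k2'
  · simp only [LinearMap.smul_apply, LinearMap.add_apply, Module.End.one_apply,
      LinearMap.mulLeft_apply, map_add, map_smul, smul_eq_mul]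
    have hr := vacF_right h u
    have e1 : s * s⁻¹ = 1 := mul_inv_cancel₀ hs
    have e2 : (1 - q)⁻¹ * (1 - q) = 1 := inv_mul_cancel₀ hq'
    rw [div_eq_mul_inv, div_eq_mul_inv] at hβ
    rw [hδ, div_eq_mul_inv, div_eq_mul_inv]
    linear_combination (1 - q)⁻¹ * β * s⁻¹ * hr + (1 - q)⁻¹ * vacF a b c d q u * hβ +
      vacF a b c d q u * e2 + (1 - q)⁻¹ * β * b * d * s⁻¹ * vacF a b c d q (oscE a c q u) * e1

/-- The moments of the Askey-Wilson functional in terms of staircase tableaux. -/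
lemma awL_eq_fugacityZ {a b c d q s α β γ δ : ℂ} (hs : s ≠ 0) (hq : q ≠ 1)
    (h : ∀ k : ℕ, a * b * c * d * q ^ k ≠ 1)
    (hα : α * ((1 + a * s) * (1 + c * s)) = 1 - q) (hβ : β * ((1 + b / s) * (1 + d / s)) = 1 - q)
    (hγ : γ = -α * (a * s * (c * s))) (hδ : δ = -β * (b / s * (d / s))) (n : ℕ) :
    awL a b c d q ((C (2 * s) * X + C (1 + s ^ 2)) ^ n) =
      (1 - q) ^ n / (∏ j ∈ Finset.range n, (α * β - γ * δ * q ^ j)) *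
        fugacityZ n (s ^ 2) α β γ δ q := by
  have hq' : 1 - q ≠ 0 := sub_ne_zero.mpr hq.symm
  have hprod : ∏ j ∈ Finset.range n, (α * β - γ * δ * q ^ j) ≠ 0 := by
    refine Finset.prod_ne_zero_iff.mpr fun j _ => ?_
    have e : α * β - γ * δ * q ^ j = α * β * (1 - a * b * c * d * q ^ j) := by
      rw [hγ, hδ]; field_simp
    rw [e]
    refine mul_ne_zero (mul_ne_zero (left_ne_zero_of_mul (hα.trans_ne hq'))
      (left_ne_zero_of_mul (hβ.trans_ne hq'))) (sub_ne_zero.mpr (h j).symm)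
  rw [(matrixAnsatz_osc hs hq h hα hβ hγ hδ).fugacityZ_eq, div_mul_eq_mul_div, mul_left_comm,
    mul_div_cancel_left₀ _ hprod, awL_apply, map_pow]
  have e : aeval (oscX a c q) (C (2 * s) * X + C (1 + s ^ 2) : ℂ[X]) = (1 - q) •
      (s ^ 2 • ((1 - q)⁻¹ • (1 + s⁻¹ • LinearMap.mulLeft ℂ (X : ℂ[X]))) +
        (1 - q)⁻¹ • (1 + s • oscE a c q)) := by
    rw [map_add, map_mul, aeval_C, aeval_C, aeval_X, oscX]
    simp only [Algebra.algebraMap_eq_smul_one, smul_mul_assoc, one_mul]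
    match_scalars <;> field_simp
    ring
  rw [e, _root_.smul_pow, LinearMap.smul_apply, map_smul, smul_eq_mul]

lemma ContinuousAt.fugacityZ {X : Type*} [TopologicalSpace X] {x : X} {α β γ δ q : X → ℂ} (n : ℕ)
    (y : ℂ) (hα : ContinuousAt α x) (hβ : ContinuousAt β x) (hγ : ContinuousAt γ x)
    (hδ : ContinuousAt δ x) (hq : ContinuousAt q x) :
    ContinuousAt (fun x => fugacityZ n y (α x) (β x) (γ x) (δ x) (q x)) x := by
  refine tendsto_finsetSum _ fun T _ => Tendsto.mul_const _ ?_
  refine tendsto_finsetProd _ fun c _ => ?_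
  simp only [StairFilling.boxWeight]
  rcases T c with _ | (_ | _ | _ | _)
  · simp only
    split_ifs
    exacts [tendsto_const_nhds, hq, tendsto_const_nhds, hq]
  exacts [hα, hβ, hγ, hδ]

lemma continuousAt_awIntegral_add {a b c d q : ℂ} {U : Set ℂ} (hU : U ∈ 𝓝 0)
    (h : ∀ t ∈ U, InDisc (a + t) b c d (q + t)) {f : ℂ → ℂ} (hf : Continuous f) :
    ContinuousAt (fun t => awIntegral (a + t) b c d (q + t) f) 0 := by
  have h1 : ∀ r : ℂ, Continuous fun t : U => r + (t : ℂ) := fun r =>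
    continuous_const.add continuous_subtype_val
  have h2 : Continuous fun t : U => awIntegral (a + (t : ℂ)) b c d (q + (t : ℂ)) f :=
    continuous_awIntegral (h1 a) continuous_const continuous_const continuous_const (h1 q)
      (fun t => h t t.2) hf
  exact (continuousOn_iff_continuous_domRestrict.mpr h2).continuousAt hU

/-- Integration against the weight is the Askey-Wilson functional. For `a ≠ 0 ≠ q` they agree on the
basis `awPhi a q`; the remaining parameters are reached by continuity of the moments of `2 x + 2`,
which both sides express by tableaux. -/
lemma InDisc.integralL_eq {a b c d q : ℂ} (h : InDisc a b c d q) :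
    h.integralL = awL a b c d q := by
  have gen : ∀ {a q : ℂ} (h : InDisc a b c d q), a ≠ 0 → q ≠ 0 → h.integralL = awL a b c d q :=
    fun h ha hq => eq_of_awPhi ha hq fun k => by
      rw [h.integralL_awPhi hq, awL_awPhi h.mul_pow_ne_one]
  have n1 : ∀ {r : ℂ}, ‖r‖ < 1 → 1 + r ≠ 0 := fun {r} hr => by
    simpa using one_sub_ne_zero_of_norm_lt_one (r := -r) (by rwa [norm_neg])
  have hq1 : ∀ {r : ℂ}, ‖r‖ < 1 → r ≠ 1 := fun hr e => by simp [e] at hr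
  have Z : ∀ {a q : ℂ} (h : InDisc a b c d q) (n : ℕ),
      awL a b c d q ((C 2 * X + C 2) ^ n) = (1 - q) ^ n / (∏ j ∈ Finset.range n,
        ((1 - q) / ((1 + a) * (1 + c)) * ((1 - q) / ((1 + b) * (1 + d))) -
          -((1 - q) / ((1 + a) * (1 + c))) * (a * c) *
          (-((1 - q) / ((1 + b) * (1 + d))) * (b * d)) * q ^ j)) *
        fugacityZ n 1 ((1 - q) / ((1 + a) * (1 + c))) ((1 - q) / ((1 + b) * (1 + d)))
          (-((1 - q) / ((1 + a) * (1 + c))) * (a * c))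
          (-((1 - q) / ((1 + b) * (1 + d))) * (b * d)) q := by
    intro a q h n
    have := awL_eq_fugacityZ (s := 1) (α := (1 - q) / ((1 + a) * (1 + c)))
      (β := (1 - q) / ((1 + b) * (1 + d))) one_ne_zero (hq1 h.q) h.mul_pow_ne_one
      (by rw [mul_one, mul_one]; exact div_mul_cancel₀ _ (mul_ne_zero (n1 h.a) (n1 h.c)))
      (by rw [div_one, div_one]; exact div_mul_cancel₀ _ (mul_ne_zero (n1 h.b) (n1 h.d))) rfl rfl n
    simpa only [mul_one, div_one, one_pow, one_add_one_eq_two] using this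
  have key : ∀ n : ℕ, h.integralL ((C 2 * X + C 2) ^ n) = awL a b c d q ((C 2 * X + C 2) ^ n) := by
    intro n
    let U : Set ℂ := {t | ‖a + t‖ < 1 ∧ ‖q + t‖ < 1}
    have hU : IsOpen U := (isOpen_lt (f := fun t : ℂ => ‖a + t‖) (by fun_prop)
      continuous_const).inter (isOpen_lt (f := fun t : ℂ => ‖q + t‖) (by fun_prop) continuous_const)
    have h0 : (0 : ℂ) ∈ U := by simpa [U] using ⟨h.a, h.q⟩
    have hd : ∀ t ∈ U, InDisc (a + t) b c d (q + t) := fun t ht => ⟨ht.2, ht.1, h.b, h.c, h.d⟩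
    have hF : ContinuousAt (fun t => awIntegral (a + t) b c d (q + t)
        fun x => ((C 2 * X + C 2 : ℂ[X]) ^ n).eval x) 0 :=
      continuousAt_awIntegral_add (hU.mem_nhds h0) hd (Polynomial.continuous _)
    have ca : ContinuousAt (fun t : ℂ => a + t) 0 := by fun_prop
    have cq : ContinuousAt (fun t : ℂ => q + t) 0 := by fun_prop
    have na : (1 + (a + 0)) * (1 + c) ≠ 0 := by
      rw [add_zero]; exact mul_ne_zero (n1 h.a) (n1 h.c)
    have cα : ContinuousAt (fun t : ℂ => (1 - (q + t)) / ((1 + (a + t)) * (1 + c))) 0 :=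
      (continuousAt_const.sub cq).div ((continuousAt_const.add ca).mul continuousAt_const) na
    have cβ : ContinuousAt (fun t : ℂ => (1 - (q + t)) / ((1 + b) * (1 + d))) 0 :=
      (continuousAt_const.sub cq).div_const _
    have cγ := cα.neg.mul (ca.mul (continuousAt_const (y := c)))
    have cδ := cβ.neg.mul (continuousAt_const (y := b * d))
    have hG : ContinuousAt (fun t => awL (a + t) b c d (q + t) ((C 2 * X + C 2) ^ n)) 0 := by
      refine ContinuousAt.congr (f := _) ?_
        (Filter.eventually_of_mem (hU.mem_nhds h0) fun t ht => (Z (hd t ht) n).symm)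
      refine ((continuousAt_const.sub cq).pow n |>.div ?_ ?_).mul
        (ContinuousAt.fugacityZ n 1 cα cβ cγ cδ cq)
      · exact tendsto_finsetProd _ fun j _ => (cα.mul cβ).sub ((cγ.mul cδ).mul (cq.pow j))
      · refine Finset.prod_ne_zero_iff.mpr fun j _ => ?_
        simp only [add_zero]
        have hα : (1 - q) / ((1 + a) * (1 + c)) ≠ 0 :=
          div_ne_zero (sub_ne_zero.mpr (hq1 h.q).symm) (mul_ne_zero (n1 h.a) (n1 h.c))
        have hβ : (1 - q) / ((1 + b) * (1 + d)) ≠ 0 :=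
          div_ne_zero (sub_ne_zero.mpr (hq1 h.q).symm) (mul_ne_zero (n1 h.b) (n1 h.d))
        intro e
        refine mul_ne_zero (mul_ne_zero hα hβ) (sub_ne_zero.mpr (h.mul_pow_ne_one j).symm) ?_
        linear_combination e
    have hne : ∀ᶠ t in 𝓝[≠] (0 : ℂ), a + t ≠ 0 ∧ q + t ≠ 0 := by
      have : ∀ r : ℂ, ∀ᶠ t in 𝓝[≠] (0 : ℂ), r + t ≠ 0 := fun r => by
        rcases eq_or_ne r 0 with rfl | hr
        · filter_upwards [self_mem_nhdsWithin] with t ht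
          simpa using ht
        · have hc : ContinuousAt (fun t : ℂ => r + t) 0 := by fun_prop
          exact (hc.eventually_ne (by simpa using hr)).filter_mono nhdsWithin_le_nhds
      exact (this a).and (this q)
    have heq : (fun t => awIntegral (a + t) b c d (q + t)
        fun x => ((C 2 * X + C 2 : ℂ[X]) ^ n).eval x) =ᶠ[𝓝[≠] 0]
        fun t => awL (a + t) b c d (q + t) ((C 2 * X + C 2) ^ n) := by
      filter_upwards [hne, nhdsWithin_le_nhds (hU.mem_nhds h0)] with t ht htU
      rw [← gen (hd t htU) ht.1 ht.2, (hd t htU).integralL_apply]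
    have := tendsto_nhds_unique_of_eventuallyEq (hF.tendsto.mono_left nhdsWithin_le_nhds)
      (hG.tendsto.mono_left nhdsWithin_le_nhds) heq
    rw [h.integralL_apply]
    simpa only [add_zero] using this
  -- the powers of `2 X + 2` span
  let S : ℂ[X] →ₗ[ℂ] ℂ[X] := (aeval (R := ℂ) (C 2 * X + C 2 : ℂ[X])).toLinearMap
  have hS : h.integralL ∘ₗ S = awL a b c d q ∘ₗ S := linearMap_ext_X_pow fun n => by
    have : S (X ^ n) = (C 2 * X + C 2) ^ n := by simp [S]
    rw [LinearMap.comp_apply, LinearMap.comp_apply, this, key]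
  refine LinearMap.ext fun p => ?_
  have hp : S (p.comp (C 2⁻¹ * (X - C 2))) = p := by
    change (p.comp (C 2⁻¹ * (X - C 2))).comp (C 2 * X + C 2) = p
    rw [comp_assoc]
    simp only [mul_comp, sub_comp, C_comp, X_comp, add_sub_cancel_right]
    rw [← mul_assoc, ← C_mul, inv_mul_cancel₀ two_ne_zero, C_1, one_mul, comp_X]
  rw [← hp]
  exact LinearMap.congr_fun hS _

/-! ### The moments -/

lemma awL_rescaled_eq_fugacityZ {a b c d q s α β γ δ : ℂ} (hs : s ≠ 0) (hq : q ≠ 1)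
    (h : ∀ k : ℕ, a / s * (b * s) * (c / s) * (d * s) * q ^ k ≠ 1)
    (hac : 1 + a * c + a + c ≠ 0) (hbd : 1 + b * d + b + d ≠ 0)
    (hα : α = (1 - q) / (1 + a * c + a + c)) (hβ : β = (1 - q) / (1 + b * d + b + d))
    (hγ : γ = -(1 - q) * (a * c) / (1 + a * c + a + c))
    (hδ : δ = -(1 - q) * (b * d) / (1 + b * d + b + d)) (n : ℕ) :
    awL (a / s) (b * s) (c / s) (d * s) q ((C (2 * s) * X + C (1 + s ^ 2)) ^ n) =
      (1 - q) ^ n / (∏ j ∈ Finset.range n, (α * β - γ * δ * q ^ j)) *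
        fugacityZ n (s ^ 2) α β γ δ q := by
  refine awL_eq_fugacityZ hs hq h ?_ ?_ ?_ ?_ n <;>
    simp only [div_mul_cancel₀ _ hs, mul_div_cancel_right₀ _ hs]
  · rw [hα, div_mul_eq_mul_div, div_eq_iff hac]
    ring
  · rw [hβ, div_mul_eq_mul_div, div_eq_iff hbd]
    ring
  · rw [hα, hγ]
    ring
  · rw [hβ, hδ]
    ring

lemma awL_X_pow_eq_fugacityZ {a b c d q α β γ δ : ℂ} (hq : q ≠ 1)
    (h : ∀ k : ℕ, a * b * c * d * q ^ k ≠ 1)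
    (hac : 1 - a * c + a * Complex.I + c * Complex.I ≠ 0)
    (hbd : 1 - b * d - b * Complex.I - d * Complex.I ≠ 0)
    (hα : α = (1 - q) / (1 - a * c + a * Complex.I + c * Complex.I))
    (hβ : β = (1 - q) / (1 - b * d - b * Complex.I - d * Complex.I))
    (hγ : γ = (1 - q) * (a * c) / (1 - a * c + a * Complex.I + c * Complex.I))
    (hδ : δ = (1 - q) * (b * d) / (1 - b * d - b * Complex.I - d * Complex.I)) (n : ℕ) :
    awL a b c d q (X ^ n) =
      (1 - q) ^ n / (2 ^ n * Complex.I ^ n * ∏ j ∈ Finset.range n, (α * β - γ * δ * q ^ j)) *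
        fugacityZ n (-1) α β γ δ q := by
  have hI := Complex.I_mul_I
  have key := awL_eq_fugacityZ (s := Complex.I) (α := α) (β := β) (γ := γ) (δ := δ)
    Complex.I_ne_zero hq h
    (by
      rw [hα, div_mul_eq_mul_div, div_eq_iff hac]
      linear_combination (1 - q) * a * c * hI)
    (by
      rw [Complex.div_I, Complex.div_I, hβ, div_mul_eq_mul_div, div_eq_iff hbd]
      linear_combination (1 - q) * b * d * hI)
    (by
      rw [hα, hγ]
      linear_combination (1 - q) / (1 - a * c + a * Complex.I + c * Complex.I) * a * c * hI)
    (by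
      rw [Complex.div_I, Complex.div_I, hβ, hδ]
      linear_combination (1 - q) / (1 - b * d - b * Complex.I - d * Complex.I) * b * d * hI) n
  have e : ((C (2 * Complex.I) * X + C (1 + Complex.I ^ 2) : ℂ[X]) ^ n) =
      (2 * Complex.I) ^ n • X ^ n := by
    rw [Complex.I_sq, add_neg_cancel, C_0, add_zero, mul_pow, ← C_pow, ← smul_eq_C_mul]
  rw [e, map_smul, smul_eq_mul, Complex.I_sq] at key
  have h2 : (2 * Complex.I) ^ n ≠ 0 := pow_ne_zero _ (mul_ne_zero two_ne_zero Complex.I_ne_zero)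
  rw [← mul_pow, mul_comm ((2 * Complex.I) ^ n), ← div_div, div_mul_eq_mul_div, eq_div_iff h2,
    mul_comm, key]

theorem theorem1p5 :
    -- the moments of the weight function, for parameters in the unit disc
    (∀ a b c d q α β γ δ : ℂ, ‖q‖ < 1 → ‖a‖ < 1 → ‖b‖ < 1 → ‖c‖ < 1 → ‖d‖ < 1 →
      α = (1 - q) / (1 - a * c + a * Complex.I + c * Complex.I) →
      β = (1 - q) / (1 - b * d - b * Complex.I - d * Complex.I) →
      γ = (1 - q) * (a * c) / (1 - a * c + a * Complex.I + c * Complex.I) →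
      δ = (1 - q) * (b * d) / (1 - b * d - b * Complex.I - d * Complex.I) →
      ∀ n : ℕ, awMoment n a b c d q =
        (1 - q) ^ n /
          (2 ^ n * Complex.I ^ n * ∏ j ∈ Finset.range n, (α * β - γ * δ * q ^ j)) *
          fugacityZ n (-1) α β γ δ q) ∧
    -- the moments of the polynomials, for general parameters
    (∀ a b c d q α β γ δ : ℂ, AWGeneric a b c d q →
      1 - a * c + a * Complex.I + c * Complex.I ≠ 0 →
      1 - b * d - b * Complex.I - d * Complex.I ≠ 0 →
      α = (1 - q) / (1 - a * c + a * Complex.I + c * Complex.I) →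
      β = (1 - q) / (1 - b * d - b * Complex.I - d * Complex.I) →
      γ = (1 - q) * (a * c) / (1 - a * c + a * Complex.I + c * Complex.I) →
      δ = (1 - q) * (b * d) / (1 - b * d - b * Complex.I - d * Complex.I) →
      HasMoments (awPoly a b c d q) (fun n =>
        (1 - q) ^ n /
          (2 ^ n * Complex.I ^ n * ∏ j ∈ Finset.range n, (α * β - γ * δ * q ^ j)) *
          fugacityZ n (-1) α β γ δ q)) ∧
    -- the general form with a fugacity `y`, where `s` is a square root of `y`
    (∀ a b c d q y s α β γ δ : ℂ, y ≠ 0 → s ^ 2 = y → ‖q‖ < 1 →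
      ‖a / s‖ < 1 → ‖b * s‖ < 1 → ‖c / s‖ < 1 → ‖d * s‖ < 1 →
      1 + a * c + a + c ≠ 0 → 1 + b * d + b + d ≠ 0 →
      α = (1 - q) / (1 + a * c + a + c) →
      β = (1 - q) / (1 + b * d + b + d) →
      γ = -(1 - q) * (a * c) / (1 + a * c + a + c) →
      δ = -(1 - q) * (b * d) / (1 + b * d + b + d) →
      ∀ n : ℕ, awIntegral (a / s) (b * s) (c / s) (d * s) q
          (fun x => (2 * s * x + 1 + y) ^ n) =
        (1 - q) ^ n / (∏ j ∈ Finset.range n, (α * β - γ * δ * q ^ j)) *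
          fugacityZ n y α β γ δ q) ∧
    -- the same for the rescaled polynomials `P_m((x - 1 - y) / (2 s))`, for general parameters
    (∀ a b c d q y s α β γ δ : ℂ, y ≠ 0 → s ^ 2 = y →
      AWGeneric (a / s) (b * s) (c / s) (d * s) q →
      1 + a * c + a + c ≠ 0 → 1 + b * d + b + d ≠ 0 →
      α = (1 - q) / (1 + a * c + a + c) →
      β = (1 - q) / (1 + b * d + b + d) →
      γ = -(1 - q) * (a * c) / (1 + a * c + a + c) →
      δ = -(1 - q) * (b * d) / (1 + b * d + b + d) →
      HasMoments
        (fun m => (awPoly (a / s) (b * s) (c / s) (d * s) q m).comp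
          (C (2 * s)⁻¹ * (X - C (1 + y))))
        (fun n =>
          (1 - q) ^ n / (∏ j ∈ Finset.range n, (α * β - γ * δ * q ^ j)) *
            fugacityZ n y α β γ δ q)) := by
  refine ⟨?_, ?_, ?_, ?_⟩
  · intro a b c d q α β γ δ hq ha hb hc hd hα hβ hγ hδ n
    have h : InDisc a b c d q := ⟨hq, ha, hb, hc, hd⟩
    have hI : ∀ r : ℂ, ‖r‖ < 1 → 1 + r * Complex.I ≠ 0 ∧ 1 - r * Complex.I ≠ 0 := fun r hr => by
      have hr' : ‖r * Complex.I‖ < 1 := by rwa [norm_mul, Complex.norm_I, mul_one]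
      refine ⟨?_, one_sub_ne_zero_of_norm_lt_one hr'⟩
      simpa using one_sub_ne_zero_of_norm_lt_one (r := -(r * Complex.I)) (by rwa [norm_neg])
    have hac : 1 - a * c + a * Complex.I + c * Complex.I ≠ 0 := fun e =>
      mul_ne_zero (hI a ha).1 (hI c hc).1 (by linear_combination e + a * c * Complex.I_mul_I)
    have hbd : 1 - b * d - b * Complex.I - d * Complex.I ≠ 0 := fun e =>
      mul_ne_zero (hI b hb).2 (hI d hd).2 (by linear_combination e + b * d * Complex.I_mul_I)
    rw [← awL_X_pow_eq_fugacityZ (fun e => by simp [e] at hq) h.mul_pow_ne_one hac hbd hα hβ hγ hδ,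
      ← h.integralL_eq, h.integralL_apply]
    simp [awMoment]
  · intro a b c d q α β γ δ h hac hbd hα hβ hγ hδ
    have hq : q ≠ 1 := by simpa using h.q_pow 1 le_rfl
    have := h.hasMoments_comp one_ne_zero (v := 0) (μ := fun n => awL a b c d q (X ^ n))
      fun n => by rw [C_1, one_mul, C_0, add_zero]
    simpa [awL_X_pow_eq_fugacityZ hq h.abcd hac hbd hα hβ hγ hδ] using this
  · rintro a b c d q _ s α β γ δ hy rfl hq ha hb hc hd hac hbd hα hβ hγ hδ n
    have h : InDisc (a / s) (b * s) (c / s) (d * s) q := ⟨hq, ha, hb, hc, hd⟩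
    have hs : s ≠ 0 := fun e => hy (by simp [e])
    rw [← awL_rescaled_eq_fugacityZ hs (fun e => by simp [e] at hq) h.mul_pow_ne_one hac hbd hα hβ
      hγ hδ, ← h.integralL_eq, h.integralL_apply]
    simp [add_assoc]
  · rintro a b c d q _ s α β γ δ hy rfl h hac hbd hα hβ hγ hδ
    have hs : s ≠ 0 := fun e => hy (by simp [e])
    exact h.hasMoments_comp (mul_ne_zero two_ne_zero hs) fun n => awL_rescaled_eq_fugacityZ hs
      (by simpa using h.q_pow 1 le_rfl) h.abcd hac hbd hα hβ hγ hδ n
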